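/- Let $n\geqslant 1$ and let $H_n$ be the Hecke algebra over the field $\mathbb{C}(q)$ with generators $T_1,\dots,T_{n-1}$ and relations $(T_i-q)(T_i+q^{-1})=0$, $T_iT_{i+1}T_i=T_{i+1}T_iT_{i+1}$, and $T_iT_j=T_jT_i$ for $|i-j|\geqslant 2$. For $1\leqslant i\leqslant n-1$ put $$F_i(a,b)=T_i+\frac{q-q^{-1}}{a^{-1}b-1}.$$ Let $\Lambda$ be a standard tableau (entries $1,\dots,n$, each occurring once, increasing along rows and down columns) whose shape is a partition $\lambda$ of $n$. Write $\Lambda(a,b)$ for the entry in row $a$ and column $b$, and let $c_i(\Lambda)=b-a$ if $i=\Lambda(a,b)$. Consider the $H_n$-valued rational function $$F_\Lambda(z_1,\dots,z_n)=\prod_{(i,j)}^{\rightarrow}F_{j-i}\bigl(q^{2c_i(\Lambda)}z_i,\,q^{2c_j(\Lambda)}z_j\bigr),$$ where the product is over the pairs $1\leqslant i<j\leqslant n$, and $(i,j)$ precedes $(i',j')$ if $j<j'$, or if $j=j'$ and $i<i'$. Let $\mathcal{H}_\Lambda\subset\mathbb{C}(q)^n$ be the subspace of all tuples with $z_i=z_j$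 whenever $i$ and $j$ stand in the same principal hook of $\Lambda$; here the $h$-th principal hook consists of the boxes $(a,b)$ of $\lambda$ with $\min(a,b)=h$. Then the restriction of $F_\Lambda(z_1,\dots,z_n)$ to $\mathcal{H}_\Lambda$ is regular at every point with $z_1=\dots=z_n\neq 0$, and it takes the same value $F_\Lambda\in H_n$ at all these points. Moreover: 1. If $k=\Lambda(a,b)$ and $k+1=\Lambda(a+1,b)$, then $F_\Lambda$ is divisible on the left by $T_k-q$, that is, $F_\Lambda=(T_k-q)\,G$ for some $G\in H_n$. 2. If $k=\Lambda(a,b)$ and $k+1=\Lambda(a,b+1)$, then $F_\Lambda$ is divisible on the left by $T_k+q^{-1}$, that is, $F_\Lambda=(T_k+q^{-1})\,G$ for some $G\in H_n$. -/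

import Mathlib

open scoped TensorProduct

noncomputable section

namespace HookFusion

/-- The ground field `ℂ(q)` of rational functions in one indeterminate. -/
abbrev K : Type := RatFunc ℂ

/-- The indeterminate `q` of `ℂ(q)`. -/
def q : K := RatFunc.X

/-! ### The Hecke algebra -/

/-- Indices `1, …, n - 1` of the generators of the Hecke algebra `H_n`. -/
abbrev GenIndex (n : ℕ) : Type := {k : ℕ // 1 ≤ k ∧ k < n}

/-- Defining relations of `H_n`: the quadratic relation, the braid relation, and commutation of
generators whose indices differ by at least two. -/
inductive HeckeRel (n : ℕ) :
    FreeAlgebra K (GenIndex n) → FreeAlgebra K (GenIndex n) → Prop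
  | quadratic (i : GenIndex n) :
      HeckeRel n
        ((FreeAlgebra.ι K i - algebraMap K _ q) * (FreeAlgebra.ι K i + algebraMap K _ q⁻¹)) 0
  | braid (i j : GenIndex n) (h : j.1 = i.1 + 1) :
      HeckeRel n
        (FreeAlgebra.ι K i * FreeAlgebra.ι K j * FreeAlgebra.ι K i)
        (FreeAlgebra.ι K j * FreeAlgebra.ι K i * FreeAlgebra.ι K j)
  | comm (i j : GenIndex n) (h : i.1 + 1 < j.1) :
      HeckeRel n
        (FreeAlgebra.ι K i * FreeAlgebra.ι K j)
        (FreeAlgebra.ι K j * FreeAlgebra.ι K i)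

/-- The Hecke algebra `H_n` over `ℂ(q)`, by generators and relations. -/
def HeckeAlgebra (n : ℕ) : Type := RingQuot (HeckeRel n)

instance (n : ℕ) : Ring (HeckeAlgebra n) := inferInstanceAs (Ring (RingQuot (HeckeRel n)))

instance (n : ℕ) : Algebra K (HeckeAlgebra n) :=
  inferInstanceAs (Algebra K (RingQuot (HeckeRel n)))

/-- The quotient map from the free algebra onto `H_n`. -/
def HeckeAlgebra.mk (n : ℕ) : FreeAlgebra K (GenIndex n) →ₐ[K] HeckeAlgebra n :=
  RingQuot.mkAlgHom K (HeckeRel n)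

/-- The generator `T_k` of `H_n`, for `1 ≤ k ≤ n - 1`. (The value `0` for other `k` is never
used.) -/
def T (n k : ℕ) : HeckeAlgebra n :=
  if h : 1 ≤ k ∧ k < n then
    HeckeAlgebra.mk n (FreeAlgebra.ι K (⟨k, h⟩ : GenIndex n))
  else 0

/-! ### Standard tableaux -/

/-- A standard tableau of shape `μ`: the numbers `1, …, n`, where `n` is the number of boxes, are
put bijectively into the boxes, increasing along each row and down each column.
Boxes are pairs (row, column), counted from `0` as in `YoungDiagram`; the number `m` is represented
by the element of `Fin n` with value `m - 1`. -/
structure StandardTableau (μ : YoungDiagram) where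
  /-- the bijection between boxes and entries -/
  fill : {c : ℕ × ℕ // c ∈ μ} ≃ Fin μ.card
  row_strict : ∀ (a b b' : ℕ) (h : (a, b) ∈ μ) (h' : (a, b') ∈ μ), b < b' →
    fill ⟨(a, b), h⟩ < fill ⟨(a, b'), h'⟩
  col_strict : ∀ (a a' b : ℕ) (h : (a, b) ∈ μ) (h' : (a', b) ∈ μ), a < a' →
    fill ⟨(a, b), h⟩ < fill ⟨(a', b), h'⟩

namespace StandardTableau

variable {μ : YoungDiagram} (Λ : StandardTableau μ)

/-- The number in `{1, …, n}` standing in the given box. -/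
def entry (c : ℕ × ℕ) (hc : c ∈ μ) : ℕ := (Λ.fill ⟨c, hc⟩ : ℕ) + 1

/-- The box containing the given number. -/
def box (i : Fin μ.card) : ℕ × ℕ := (Λ.fill.symm i).1

/-- The content (column minus row) of the box containing the given number. -/
def content (i : Fin μ.card) : ℤ := ((Λ.box i).2 : ℤ) - ((Λ.box i).1 : ℤ)

end StandardTableau

/-- The principal hooks of `μ`, each given by its corner `(h, h)`. -/
abbrev PrincipalHook (μ : YoungDiagram) : Type := {h : ℕ // (h, h) ∈ μ}

/-- The principal hook containing the given number: the box `(a, b)` lies in the hook with corner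
`(min a b, min a b)`. -/
def StandardTableau.hook {μ : YoungDiagram} (Λ : StandardTableau μ) (i : Fin μ.card) :
    PrincipalHook μ :=
  ⟨min (Λ.box i).1 (Λ.box i).2,
    μ.up_left_mem (min_le_left _ _) (min_le_right _ _) (Λ.fill.symm i).2⟩

/-! ### Rational functions with values in the Hecke algebra -/

/-- The field of rational functions over `ℂ(q)` in the variables `y_s`, `s : S`. -/
abbrev RatField (S : Type) : Type := FractionRing (MvPolynomial S K)

/-- Rational functions of the variables `y_s`, `s : S`, with values in `H_n`. -/
abbrev HeckeRat (S : Type) (n : ℕ) : Type := RatField S ⊗[K] HeckeAlgebra n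

/-- Polynomials in the variables `y_s`, `s : S`, with coefficients in `H_n`. -/
abbrev HeckePoly (S : Type) (n : ℕ) : Type := MvPolynomial S K ⊗[K] HeckeAlgebra n

/-- A polynomial with coefficients in `H_n`, seen as a rational function. -/
def HeckePoly.toRat {S : Type} {n : ℕ} : HeckePoly S n →ₗ[K] HeckeRat S n :=
  (IsScalarTower.toAlgHom K (MvPolynomial S K) (RatField S)).toLinearMap.rTensor (HeckeAlgebra n)

/-- The value in `H_n` of a polynomial with coefficients in `H_n` at a point `y`. -/
def HeckePoly.eval {S : Type} {n : ℕ} (y : S → K) : HeckePoly S n →ₗ[K] HeckeAlgebra n :=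
  (TensorProduct.lid K (HeckeAlgebra n)).toLinearMap ∘ₗ
    (MvPolynomial.aeval y : MvPolynomial S K →ₐ[K] K).toLinearMap.rTensor (HeckeAlgebra n)

/-- The rational function `f` is regular at the point `y` and has the value `v` there:
`f = N / D` for a polynomial `N` with coefficients in `H_n` and a scalar polynomial `D` with
`D(y) ≠ 0`, and `v = N(y) / D(y)`. -/
def IsRegularWithValue {S : Type} {n : ℕ} (f : HeckeRat S n) (y : S → K)
    (v : HeckeAlgebra n) : Prop :=
  ∃ (N : HeckePoly S n) (D : MvPolynomial S K),
    MvPolynomial.eval y D ≠ 0 ∧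
    algebraMap (MvPolynomial S K) (RatField S) D • f = HeckePoly.toRat N ∧
    v = (MvPolynomial.eval y D)⁻¹ • HeckePoly.eval y N

/-! ### The fusion product -/

/-- `F_k(a, b) = T_k + (q - q⁻¹) / (a⁻¹ b - 1)`. -/
def factor {S : Type} (n k : ℕ) (a b : RatField S) : HeckeRat S n :=
  (1 : RatField S) ⊗ₜ[K] T n k
    + algebraMap (RatField S) (HeckeRat S n) (algebraMap K (RatField S) (q - q⁻¹) / (a⁻¹ * b - 1))

/-- The pairs `(i, j)` with `i < j`, where `(i, j)` precedes `(i', j')` if `j < j'`, or if `j = j'`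
and `i < i'`. -/
def orderedPairs (n : ℕ) : List (Fin n × Fin n) :=
  (List.finRange n).flatMap fun j =>
    ((List.finRange n).filter fun i => decide (i < j)).map fun i => (i, j)

namespace StandardTableau

variable {μ : YoungDiagram} (Λ : StandardTableau μ)

/-- `q^{2 c_i(Λ)} z_i` for the generic point `z` of the space of tuples that are constant on the
principal hooks of `Λ`: the linear coordinates `y_h` of this space are indexed by the principal
hooks `h`, and `z_i = y_h` if `i` stands in the hook `h`. -/
def w (i : Fin μ.card) : RatField (PrincipalHook μ) :=
  algebraMap K _ (q ^ (2 * Λ.content i)) *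
    algebraMap (MvPolynomial (PrincipalHook μ) K) _ (MvPolynomial.X (Λ.hook i))

/-- The restriction to the space of tuples `z` that are constant on the principal hooks of `Λ` of
the ordered product of the `F_{j-i}(q^{2 c_i(Λ)} z_i, q^{2 c_j(Λ)} z_j)`. -/
def fusionProduct : HeckeRat (PrincipalHook μ) μ.card :=
  ((orderedPairs μ.card).map fun p =>
    factor μ.card ((p.2 : ℕ) - (p.1 : ℕ)) (Λ.w p.1) (Λ.w p.2)).prod

/-- `F` is the element `F_Λ` of `H_n`: the restricted product is regular at every point of the
punctured line `z_1 = ⋯ = z_n ≠ 0`, and `F` is its value at each of these points. -/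
def IsFusionElement (F : HeckeAlgebra μ.card) : Prop :=
  ∀ c : K, c ≠ 0 → IsRegularWithValue Λ.fusionProduct (fun _ => c) F

end StandardTableau

end HookFusion

end

/-! After clearing denominators, `baxter T e k a b` is (b - a) F_k(a, b), and the Yang–Baxter
equation holds for it without any division. The factor of two consecutive boxes can therefore be
brought to the left or the right end of the whole product (`fullWord_eq_left`, `fullWord_eq_right`),
and exchanging two consecutive boxes intertwines the two products (`crossing_mul_fullWord`). If the
two boxes are neighbours with the same variable, that factor is proportional to T_k + t⁻¹ or T_k -
t, so the product is an eigenvector of a generator from each side.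

Regularity: on the line only pairs of boxes on one diagonal give poles. In the tableau filled hook
by hook, arm before leg, every box followed later by one of its diagonal is followed immediately by
a neighbour with the same variable, and the eigenvector relation cancels the pole
(`exists_mul_strand`). This works even with independent variables for the arm and the leg of each
hook. Other tableaux of the shape are reached by exchanging consecutive incomparable boxes; their
contents differ by at least 2, so the exchanging factors are invertible on the line (`HasVal.swap`).

Divisibility: since the value exists on the larger space with arms and legs separated, it can be
computed along any specialization that still gives distinct variables to the boxes of each diagonal.
For (a, b), (a, b + 1) with a ≤ b both boxes carry an arm variable; for a = b + 1 the leg of hook b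
is identified with the next arm. Lower down such an identification would destroy separation, and
induction on the row takes over: the pair just above, a vertical pair in one hook, and the braid
relation together force the claim (`gen_sub_mul_of_row`). Columns follow by transposition, which
replaces t by -t⁻¹; this is why t is a general parameter. Finally, being annihilated by one factor
of the quadratic relation means being divisible by the other (`exists_eq_mul`). -/

namespace HeckeFusion

/-! ### Ordered products over pairs of letters -/

section Words

variable {α M : Type*} [Monoid M]

/-- The ordered product of the factors by which a new letter `u` is carried through the
letters of a list, the last of them receiving the index `s + 1`. -/
def strand (g : ℕ → α → α → M) (s : ℕ) : List α → α → M
  | [], _ => 1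
  | a :: L, u => g (s + L.length + 1) a u * strand g s L u

/-- The ordered product of the strands of the letters of the second list, which arrive one
after the other behind the letters of the first. -/
def braidFrom (g : ℕ → α → α → M) : List α → List α → M
  | _, [] => 1
  | A, u :: R => strand g 0 A u * braidFrom g (A ++ [u]) R

/-- The ordered product over all pairs of letters of a list. -/
def fullWord (g : ℕ → α → α → M) (L : List α) : M := braidFrom g [] L

theorem strand_append (g : ℕ → α → α → M) (s : ℕ) (A C : List α) (u : α) :
    strand g s (A ++ C) u = strand g (s + C.length) A u * strand g s C u := by
  induction A with
  | nil => simp [strand]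
  | cons a A ih =>
    simp only [List.cons_append, strand, ih, mul_assoc, List.length_append]
    congr 2
    omega

theorem braidFrom_append (g : ℕ → α → α → M) (A B C : List α) :
    braidFrom g A (B ++ C) = braidFrom g A B * braidFrom g (A ++ B) C := by
  induction B generalizing A with
  | nil => simp [braidFrom]
  | cons u B ih => simp [braidFrom, ih, mul_assoc]

theorem fullWord_append (g : ℕ → α → α → M) (A B : List α) :
    fullWord g (A ++ B) = fullWord g A * braidFrom g A B := by
  simp [fullWord, braidFrom_append]

theorem fullWord_concat (g : ℕ → α → α → M) (A : List α) (u : α) :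
    fullWord g (A ++ [u]) = fullWord g A * strand g 0 A u := by
  simp [fullWord_append, braidFrom]

theorem map_strand {N : Type*} [Monoid N] (f : M →* N) (g : ℕ → α → α → M) (s : ℕ)
    (L : List α) (u : α) :
    f (strand g s L u) = strand (fun k a b => f (g k a b)) s L u := by
  induction L with
  | nil => simp [strand]
  | cons a L ih => simp [strand, ih]

theorem map_fullWord {N : Type*} [Monoid N] (f : M →* N) (g : ℕ → α → α → M) (L : List α) :
    f (fullWord g L) = fullWord (fun k a b => f (g k a b)) L := by
  induction L using List.reverseRecOn with
  | nil => simp [fullWord, braidFrom]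
  | append_singleton L u ih => simp [fullWord_concat, ih, map_strand]

theorem strand_comp {β : Type*} (g : ℕ → α → α → M) (w : β → α) (s : ℕ) (L : List β) (u : β) :
    strand (fun k a b => g k (w a) (w b)) s L u = strand g s (L.map w) (w u) := by
  induction L with
  | nil => simp [strand]
  | cons a L ih => simp [strand, ih]

theorem fullWord_comp {β : Type*} (g : ℕ → α → α → M) (w : β → α) (L : List β) :
    fullWord (fun k a b => g k (w a) (w b)) L = fullWord g (L.map w) := by
  induction L using List.reverseRecOn with
  | nil => simp [fullWord, braidFrom]
  | append_singleton L u ih => simp [fullWord_concat, ih, strand_comp]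

end Words

/-! ### Scalar products over pairs of letters -/

section PairProd

variable {α R : Type*} [CommMonoid R]

/-- The product of `s a b` over all pairs of letters `a`, `b` of a list, `a` standing first. -/
def pairProd (s : α → α → R) : List α → R
  | [] => 1
  | a :: L => (L.map (s a)).prod * pairProd s L

theorem pairProd_concat (s : α → α → R) (L : List α) (u : α) :
    pairProd s (L ++ [u]) = pairProd s L * (L.map fun a => s a u).prod := by
  induction L with
  | nil => simp [pairProd]
  | cons a L ih =>
    simp only [List.cons_append, pairProd, ih, List.map_append, List.prod_append, List.map_cons,
      List.map_nil, List.prod_cons, List.prod_nil, mul_one]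
    ac_rfl

theorem pairProd_swap (s : α → α → R) (A B : List α) (u v : α) (h : s u v = s v u) :
    pairProd s (A ++ u :: v :: B) = pairProd s (A ++ v :: u :: B) := by
  induction A with
  | nil =>
    simp only [List.nil_append, pairProd, List.map_cons, List.prod_cons, h]
    ac_rfl
  | cons a A ih =>
    simp only [List.cons_append, pairProd, ih]
    congr 1
    exact (((List.Perm.swap v u B).append_left A).map _).prod_eq

theorem map_pairProd {S : Type*} [CommMonoid S] (f : R →* S) (s : α → α → R) (L : List α) :
    f (pairProd s L) = pairProd (fun a b => f (s a b)) L := by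
  induction L with
  | nil => simp [pairProd]
  | cons a L ih => simp [pairProd, ih, map_list_prod, Function.comp_def]

theorem pairProd_congr {s t : α → α → R} {L : List α} (h : L.Pairwise fun a b => s a b = t a b) :
    pairProd s L = pairProd t L := by
  induction L with
  | nil => rfl
  | cons a L ih =>
    rw [List.pairwise_cons] at h
    simp only [pairProd, ih h.2, List.map_congr_left h.1]

theorem pairProd_mul (s t : α → α → R) (L : List α) :
    pairProd (fun a b => s a b * t a b) L = pairProd s L * pairProd t L := by
  induction L with
  | nil => simp [pairProd]
  | cons a L ih =>
    simp only [pairProd, ih, List.prod_map_mul]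
    ac_rfl

theorem pairProd_ne_zero {R : Type*} [CommRing R] [IsDomain R] {s : α → α → R} {L : List α}
    (h : L.Pairwise fun a b => s a b ≠ 0) : pairProd s L ≠ 0 := by
  induction L with
  | nil => simp [pairProd]
  | cons a L ih =>
    rw [List.pairwise_cons] at h
    refine mul_ne_zero ?_ (ih h.2)
    rw [Ne, List.prod_eq_zero_iff]
    simpa using h.1

theorem fullWord_smul {R B : Type*} [CommRing R] [Ring B] [Algebra R B] (s : α → α → R)
    (g : ℕ → α → α → B) (L : List α) :
    fullWord (fun k a b => s a b • g k a b) L = pairProd s L • fullWord g L := by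
  have hs : ∀ (L : List α) (u : α), strand (fun k a b => s a b • g k a b) 0 L u =
      (L.map fun a => s a u).prod • strand g 0 L u := by
    intro L u
    induction L with
    | nil => simp [strand]
    | cons a L ih => simp [strand, ih, smul_smul, mul_comm]
  induction L using List.reverseRecOn with
  | nil => simp [fullWord, braidFrom, pairProd]
  | append_singleton L u ih =>
    simp only [fullWord_concat, ih, hs, pairProd_concat, smul_mul_assoc, mul_smul_comm, smul_smul,
      mul_comm]

end PairProd

/-! ### Baxterized generators and the Yang–Baxter equation -/

section YangBaxter

variable {R B : Type*} [CommRing R] [Ring B] [Algebra R B]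

/-- The elements `T 1, …, T (n - 1)` satisfy the relations of the Hecke algebra `H_n`, with
quadratic relation `T² = e T + 1`. -/
structure IsHecke (n : ℕ) (e : R) (T : ℕ → B) : Prop where
  quad : ∀ k, 1 ≤ k → k < n → T k * T k = e • T k + 1
  braid : ∀ k, 1 ≤ k → k + 1 < n → T k * T (k + 1) * T k = T (k + 1) * T k * T (k + 1)
  comm : ∀ i j, 1 ≤ i → i + 1 < j → j < n → T i * T j = T j * T i

/-- The Baxterized generator `T_k + e / (a⁻¹ b - 1)`, multiplied by `b - a`. -/
def baxter (T : ℕ → B) (e : R) (k : ℕ) (a b : R) : B := (b - a) • T k + (e * a) • (1 : B)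

variable {n : ℕ} {e : R} {T : ℕ → B}

theorem baxter_mul_swap (h : IsHecke n e T) {k : ℕ} (hk : 1 ≤ k) (hkn : k < n) (a b : R) :
    baxter T e k a b * baxter T e k b a = (e ^ 2 * a * b - (b - a) ^ 2) • (1 : B) := by
  have hq := h.quad k hk hkn
  simp only [baxter, add_mul, mul_add, smul_mul_assoc, mul_smul_comm, one_mul, mul_one]
  linear_combination (norm := module) ((b - a) * (a - b)) • hq

theorem yangBaxter (h : IsHecke n e T) {k : ℕ} (hk : 1 ≤ k) (hkn : k + 1 < n) (a b c : R) :
    baxter T e k a b * baxter T e (k + 1) a c * baxter T e k b c =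
      baxter T e (k + 1) b c * baxter T e k a c * baxter T e (k + 1) a b := by
  have hq := h.quad k hk (by omega)
  have hq' := h.quad (k + 1) (by omega) hkn
  have hb := h.braid k hk hkn
  simp only [baxter, add_mul, mul_add, smul_mul_assoc, mul_smul_comm, one_mul, mul_one]
  linear_combination (norm := module) ((b - a) * (c - a) * (c - b)) • hb
    + ((b - a) * (e * a) * (c - b)) • hq - ((c - b) * (e * a) * (b - a)) • hq'

theorem IsHecke.commute (h : IsHecke n e T) {i j : ℕ} (hi : 1 ≤ i) (hj : 1 ≤ j) (hin : i < n)
    (hjn : j < n) (hij : i + 1 < j ∨ j + 1 < i) : Commute (T i) (T j) := by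
  rcases hij with hij | hij
  · exact h.comm i j hi hij hjn
  · exact (h.comm j i hj hij hin).symm

theorem Commute.baxter_right {x : B} {k : ℕ} (hx : Commute x (T k)) (a b : R) :
    Commute x (baxter T e k a b) :=
  (hx.smul_right _).add_right ((Commute.one_right x).smul_right _)

variable {α : Type*} (w : α → R)

/-- The Baxterized generator for letters with given weights. -/
def crossing (T : ℕ → B) (e : R) (w : α → R) (k : ℕ) (a b : α) : B := baxter T e k (w a) (w b)

theorem commute_strand {x : B} {s : ℕ} {L : List α} {u : α}
    (hx : ∀ k, s < k → k ≤ s + L.length → Commute x (T k)) :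
    Commute x (strand (crossing T e w) s L u) := by
  induction L with
  | nil => simp [strand]
  | cons a L ih =>
    simp only [List.length_cons] at hx
    exact (Commute.baxter_right (hx _ (by omega) (by omega)) _ _).mul_right
      (ih fun k h1 h2 => hx k h1 (by omega))

theorem commute_fullWord {x : B} {L : List α}
    (hx : ∀ k, 1 ≤ k → k < L.length → Commute x (T k)) :
    Commute x (fullWord (crossing T e w) L) := by
  induction L using List.reverseRecOn with
  | nil => simp [fullWord, braidFrom]
  | append_singleton L u ih =>
    simp only [List.length_append, List.length_singleton] at hx
    rw [fullWord_concat]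
    exact (ih fun k h1 h2 => hx k h1 (by omega)).mul_right
      (commute_strand w fun k h1 h2 => hx k (by omega) (by omega))

theorem commute_strand_low (h : IsHecke n e T) {j s : ℕ} {L : List α} {u : α} (a b : α)
    (hj : 1 ≤ j) (hjs : j < s) (hs : s + L.length < n) :
    Commute (crossing T e w j a b) (strand (crossing T e w) s L u) :=
  commute_strand w fun _ h1 h2 =>
    (Commute.baxter_right (h.commute (by omega) hj (by omega) (by omega) (by omega)) _ _).symm

theorem commute_strand_high (h : IsHecke n e T) {j s : ℕ} {L : List α} {u : α} (a b : α)
    (hjs : s + L.length + 1 < j) (hjn : j < n) :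
    Commute (crossing T e w j a b) (strand (crossing T e w) s L u) :=
  commute_strand w fun _ h1 h2 =>
    (Commute.baxter_right (h.commute (by omega) (by omega) (by omega) (by omega) (by omega)) _ _).symm

/-- The factor of u and v travels from right to left through the letters of A, one Yang–Baxter move
per letter; its index rises from 1 to |A| + 1. -/
theorem strand_mul_strand (h : IsHecke n e T) (A : List α) (u v : α) (hA : A.length + 1 < n) :
    strand (crossing T e w) 0 A u * strand (crossing T e w) 1 A v * crossing T e w 1 u v =
      crossing T e w (A.length + 1) u v *
        (strand (crossing T e w) 0 A v * strand (crossing T e w) 1 A u) := by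
  induction A with
  | nil => simp [strand]
  | cons a A ih =>
    simp only [List.length_cons] at hA ⊢
    have ih := ih (by omega)
    simp only [strand, zero_add]
    rw [show 1 + A.length + 1 = A.length + 1 + 1 by omega]
    have c1 := commute_strand_high w h (L := A) (u := u) (s := 0) (j := A.length + 1 + 1) a v
      (by omega) hA
    have c2 := commute_strand_high w h (L := A) (u := v) (s := 0) (j := A.length + 1 + 1) a u
      (by omega) hA
    have yb := yangBaxter h (k := A.length + 1) (by omega) hA (w a) (w u) (w v)
    change crossing T e w _ a u * crossing T e w _ a v * crossing T e w _ u v =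
      crossing T e w _ u v * crossing T e w _ a v * crossing T e w _ a u at yb
    generalize strand (crossing T e w) 0 A u = Su at *
    generalize strand (crossing T e w) 0 A v = Sv at *
    generalize strand (crossing T e w) 1 A u = Su' at *
    generalize strand (crossing T e w) 1 A v = Sv' at *
    calc _ = crossing T e w (A.length + 1) a u * (Su * crossing T e w (A.length + 1 + 1) a v) *
            Sv' * crossing T e w 1 u v := by simp only [mul_assoc]
      _ = crossing T e w (A.length + 1) a u * crossing T e w (A.length + 1 + 1) a v *
            (Su * Sv' * crossing T e w 1 u v) := by rw [← c1.eq]; simp only [mul_assoc]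
      _ = crossing T e w (A.length + 1) a u * crossing T e w (A.length + 1 + 1) a v *
            crossing T e w (A.length + 1) u v * (Sv * Su') := by rw [ih]; simp only [mul_assoc]
      _ = crossing T e w (A.length + 1 + 1) u v * crossing T e w (A.length + 1) a v *
            (crossing T e w (A.length + 1 + 1) a u * Sv) * Su' := by
              rw [yb]; simp only [mul_assoc]
      _ = _ := by rw [c2.eq]; simp only [mul_assoc]

theorem crossing_mul_strand (h : IsHecke n e T) (A C : List α) (u v b : α)
    (hn : A.length + C.length + 2 < n) :
    crossing T e w (C.length + 1) u v * strand (crossing T e w) 0 (A ++ u :: v :: C) b =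
      strand (crossing T e w) 0 (A ++ v :: u :: C) b * crossing T e w (C.length + 2) u v := by
  have c1 := commute_strand_low w h (L := A) (u := b) (s := C.length + 2) (j := C.length + 1) u v
    (by omega) (by omega) (by omega)
  have c2 := commute_strand_high w h (L := C) (u := b) (s := 0) (j := C.length + 2) u v
    (by omega) (by omega)
  have yb := yangBaxter h (k := C.length + 1) (by omega) (by omega) (w u) (w v) (w b)
  change crossing T e w _ u v * crossing T e w (C.length + 2) u b * crossing T e w _ v b =
      crossing T e w (C.length + 2) v b * crossing T e w _ u b *
        crossing T e w (C.length + 2) u v at yb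
  simp only [strand_append, strand, List.length_cons, zero_add]
  rw [show C.length + 1 + 1 = C.length + 2 by omega]
  generalize strand (crossing T e w) 0 C b = S at *
  generalize strand (crossing T e w) (C.length + 2) A b = S' at *
  calc _ = S' * (crossing T e w (C.length + 1) u v * crossing T e w (C.length + 2) u b *
            crossing T e w (C.length + 1) v b) * S := by
          rw [← mul_assoc, c1.eq]; simp only [mul_assoc]
    _ = S' * crossing T e w (C.length + 2) v b * crossing T e w (C.length + 1) u b *
          (crossing T e w (C.length + 2) u v * S) := by rw [yb]; simp only [mul_assoc]
    _ = _ := by rw [c2.eq]; simp only [mul_assoc]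

/-- Each letter of E arrives after u and v and so costs one Yang–Baxter move, raising the index by
one. -/
theorem crossing_mul_braidFrom (h : IsHecke n e T) (A C E : List α) (u v : α)
    (hn : A.length + C.length + E.length + 2 ≤ n) :
    crossing T e w (C.length + 1) u v * braidFrom (crossing T e w) (A ++ u :: v :: C) E =
      braidFrom (crossing T e w) (A ++ v :: u :: C) E *
        crossing T e w (C.length + E.length + 1) u v := by
  induction E generalizing C with
  | nil => simp [braidFrom]
  | cons b E ih =>
    simp only [List.length_cons] at hn ⊢
    have ih := ih (C ++ [b]) (by simp only [List.length_append, List.length_singleton]; omega)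
    simp only [List.length_append, List.length_singleton] at ih
    simp only [braidFrom, List.append_assoc, List.cons_append]
    rw [← mul_assoc, crossing_mul_strand w h A C u v b (by omega), mul_assoc, ih, ← mul_assoc]
    congr 2
    omega

/-- The word of `A u v E` with the crossing of `u` and `v` taken out. -/
def splitWord (T : ℕ → B) (e : R) (w : α → R) (A : List α) (u v : α) (E : List α) : B :=
  fullWord (crossing T e w) A *
    (strand (crossing T e w) 0 A v * strand (crossing T e w) 1 A u) *
      braidFrom (crossing T e w) (A ++ u :: v :: []) E

theorem fullWord_eq_left (h : IsHecke n e T) (A E : List α) (u v : α)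
    (hn : A.length + E.length + 2 ≤ n) :
    fullWord (crossing T e w) (A ++ u :: v :: E) =
      crossing T e w (A.length + 1) u v * splitWord T e w A u v E := by
  have hc : Commute (crossing T e w (A.length + 1) u v) (fullWord (crossing T e w) A) :=
    commute_fullWord w fun k h1 h2 =>
      (Commute.baxter_right (h.commute (by omega) (by omega) (by omega) (by omega) (by omega)) _ _).symm
  have e1 : fullWord (crossing T e w) (A ++ u :: v :: E) = fullWord (crossing T e w) A *
      (strand (crossing T e w) 0 A u * strand (crossing T e w) 1 A v * crossing T e w 1 u v) *
        braidFrom (crossing T e w) (A ++ u :: v :: []) E := by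
    simp [fullWord_append, braidFrom, strand_append, strand, mul_assoc]
  rw [e1, strand_mul_strand w h A u v (by omega), splitWord]
  simp only [← mul_assoc, hc.eq]

theorem fullWord_eq_right (h : IsHecke n e T) (A E : List α) (u v : α)
    (hn : A.length + E.length + 2 ≤ n) :
    fullWord (crossing T e w) (A ++ u :: v :: E) =
      splitWord T e w A v u E * crossing T e w (E.length + 1) u v := by
  have e1 : fullWord (crossing T e w) (A ++ u :: v :: E) = fullWord (crossing T e w) A *
      (strand (crossing T e w) 0 A u * strand (crossing T e w) 1 A v) * (crossing T e w 1 u v *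
        braidFrom (crossing T e w) (A ++ u :: v :: []) E) := by
    simp [fullWord_append, braidFrom, strand_append, strand, mul_assoc]
  have := crossing_mul_braidFrom w h A [] E u v (by simpa using hn)
  simp only [List.length_nil, zero_add] at this
  rw [e1, this, splitWord]
  simp only [mul_assoc]

/-- Both sides are the same `splitWord` between two crossings. All later comparisons of two tableaux
rest on this exchange rule. -/
theorem crossing_mul_fullWord (h : IsHecke n e T) (A E : List α) (u v : α)
    (hn : A.length + E.length + 2 ≤ n) :
    crossing T e w (A.length + 1) u v * fullWord (crossing T e w) (A ++ v :: u :: E) =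
      fullWord (crossing T e w) (A ++ u :: v :: E) * crossing T e w (E.length + 1) v u := by
  rw [fullWord_eq_right w h A E v u hn, fullWord_eq_left w h A E u v hn, mul_assoc]

end YangBaxter

/-! ### Special positions and cancellation of poles -/

section Divisibility

variable {R B : Type*} [CommRing R] [Ring B] [Algebra R B] {n : ℕ} {e : R} {T : ℕ → B}

/-- The parameter σ allows both kinds of neighbours: σ = t for a step to the right, σ = -t⁻¹ for a
step down, with the same e = t - t⁻¹. -/
theorem baxter_of_eq {σ σ' : R} (hσ : σ * σ' = 1) (he : e = σ - σ') (k : ℕ) {a b : R}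
    (hb : b = σ ^ 2 * a) :
    baxter T e k a b = ((σ ^ 2 - 1) * a) • (T k + σ' • (1 : B)) := by
  have h : e * a = (σ ^ 2 - 1) * a * σ' := by
    rw [he]; linear_combination (-(σ * a)) * hσ
  rw [baxter, hb, h]
  module

theorem IsHecke.add_mul_sub (h : IsHecke n e T) {σ σ' : R} (hσ : σ * σ' = 1) (he : e = σ - σ')
    {k : ℕ} (hk : 1 ≤ k) (hkn : k < n) :
    (T k + σ' • (1 : B)) * (T k - σ • (1 : B)) = 0 := by
  have hq := h.quad k hk hkn
  rw [he] at hq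
  have h1 : (σ * σ') • (1 : B) = 1 := by rw [hσ, one_smul]
  simp only [add_mul, mul_sub, smul_mul_assoc, mul_smul_comm, one_mul, mul_one]
  linear_combination (norm := module) hq - h1

theorem IsHecke.sub_mul_add (h : IsHecke n e T) {σ σ' : R} (hσ : σ * σ' = 1) (he : e = σ - σ')
    {k : ℕ} (hk : 1 ≤ k) (hkn : k < n) :
    (T k - σ • (1 : B)) * (T k + σ' • (1 : B)) = 0 := by
  have hq := h.quad k hk hkn
  rw [he] at hq
  have h1 : (σ * σ') • (1 : B) = 1 := by rw [hσ, one_smul]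
  simp only [sub_mul, mul_add, smul_mul_assoc, mul_smul_comm, one_mul, mul_one]
  linear_combination (norm := module) hq - h1

variable {α : Type*} (w : α → R)

theorem fullWord_mul_gen (h : IsHecke n e T) {σ σ' : R} (hσ : σ * σ' = 1) (he : e = σ - σ')
    (A E : List α) (u v : α) (hn : A.length + E.length + 2 ≤ n) (hw : w v = σ ^ 2 * w u) :
    fullWord (crossing T e w) (A ++ u :: v :: E) * T (E.length + 1) =
      σ • fullWord (crossing T e w) (A ++ u :: v :: E) := by
  have := h.add_mul_sub hσ he (k := E.length + 1) (by omega) (by omega)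
  rw [← sub_eq_zero, ← mul_one (σ • _), smul_mul_assoc, ← mul_smul_comm, ← mul_sub,
    fullWord_eq_right w h A E u v hn, crossing, baxter_of_eq hσ he _ hw, mul_assoc,
    smul_mul_assoc, this, smul_zero, mul_zero]

theorem gen_sub_mul_fullWord (h : IsHecke n e T) {σ σ' : R} (hσ : σ * σ' = 1) (he : e = σ - σ')
    (A E : List α) (u v : α) (hn : A.length + E.length + 2 ≤ n) (hw : w v = σ ^ 2 * w u) :
    (T (A.length + 1) - σ • 1) * fullWord (crossing T e w) (A ++ u :: v :: E) = 0 := by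
  have := h.sub_mul_add hσ he (k := A.length + 1) (by omega) (by omega)
  rw [fullWord_eq_left w h A E u v hn, crossing, baxter_of_eq hσ he _ hw, ← mul_assoc,
    mul_smul_comm, this, smul_zero, zero_mul]

/-- Every letter `p` of `L` marked by `P` is followed by an unmarked letter whose weight is in
special position to that of `p`, and `X` is an eigenvector of the corresponding generator.
Then the factor of `strand 0 L m` belonging to `p` contributes a factor `w m - w p`. -/
theorem exists_mul_strand (h : IsHecke n e T) (m : α) (P : α → Prop) [DecidablePred P]
    (L : List α) (hL : L.length < n) (X : B)
    (hX : ∀ A p C, L = A ++ p :: C → P p → ∃ r C' σ σ', C = r :: C' ∧ ¬ P r ∧ σ * σ' = 1 ∧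
      e = σ - σ' ∧ w r = σ ^ 2 * w p ∧ X * T (C'.length + 1) = σ • X) :
    ∃ X', X * strand (crossing T e w) 0 L m =
      (L.map fun p => if P p then w m - w p else 1).prod • X' := by
  induction hN : L.length using Nat.strong_induction_on generalizing L X with
  | _ N ih =>
  rcases L with _ | ⟨a, L⟩
  · exact ⟨X, by simp [strand]⟩
  simp only [List.length_cons] at hL hN
  by_cases ha : P a
  · obtain ⟨r, L, σ, σ', rfl, hr, hσ, he, hw, hXr⟩ := hX [] a L rfl ha
    simp only [List.length_cons] at hL hN
    obtain ⟨X', hX'⟩ := ih L.length (by omega) L (by omega)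
      -- This is X times the factors of `a` and `r`, divided by `w m - w a`: in the first summand
      -- that scalar is the coefficient of T in the factor of `a`, and in the second it appears
      -- because X is an eigenvector of the factor of `r` with eigenvalue `σ * (w m - w a)`.
      (X * T (L.length + 2) * crossing T e w (L.length + 1) r m + (e * w a * σ) • X) (by
        -- The generators of the remaining relations have index at most two below |L| + 1, hence
        -- commute with everything newly multiplied to X.
        rintro A p C rfl hp
        obtain ⟨r', C', τ, τ', rfl, hr', hτ, he', hw', hX'⟩ := hX (a :: r :: A) p C rfl hp
        refine ⟨r', C', τ, τ', rfl, hr', hτ, he', hw', ?_⟩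
        simp only [List.length_append, List.length_cons] at hL ⊢
        have c1 : Commute (T (A.length + (C'.length + 1 + 1) + 2)) (T (C'.length + 1)) :=
          h.commute (by omega) (by omega) (by omega) (by omega) (by omega)
        have c2 : Commute (T (C'.length + 1))
            (crossing T e w (A.length + (C'.length + 1 + 1) + 1) r m) :=
          Commute.baxter_right
            (h.commute (by omega) (by omega) (by omega) (by omega) (by omega)) _ _
        rw [add_mul, mul_assoc, ← c2.eq, ← mul_assoc, mul_assoc X, c1.eq, ← mul_assoc, hX']
        simp only [smul_mul_assoc, smul_add, hX', smul_smul, mul_comm τ]) rfl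
    refine ⟨X', ?_⟩
    simp only [List.map_cons, List.prod_cons, if_pos ha, if_neg hr, one_mul, mul_smul, ← hX']
    simp only [strand, zero_add, List.length_cons, ← mul_assoc, ← smul_mul_assoc]
    congr 1
    have hXr' : X * crossing T e w (L.length + 1) r m = (σ * (w m - w a)) • X := by
      simp only [crossing, baxter, mul_add, mul_smul_comm, mul_one, hXr, hw, he, smul_smul,
        ← add_smul]
      congr 1
      linear_combination (-(σ * w a)) * hσ
    rw [crossing, baxter, mul_add, mul_smul_comm, mul_smul_comm, mul_one, add_mul, smul_mul_assoc,
      smul_mul_assoc, hXr', smul_add, smul_smul, smul_smul,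
      show L.length + 1 + 1 = L.length + 2 from rfl]
    module
  · obtain ⟨X', hX'⟩ := ih L.length (by omega) L (by omega)
      (X * crossing T e w (L.length + 1) a m) (by
        rintro A p C rfl hp
        obtain ⟨r', C', τ, τ', rfl, hr', hτ, he', hw', hX'⟩ := hX (a :: A) p C rfl hp
        refine ⟨r', C', τ, τ', rfl, hr', hτ, he', hw', ?_⟩
        simp only [List.length_append, List.length_cons] at hL ⊢
        have c2 : Commute (T (C'.length + 1))
            (crossing T e w (A.length + (C'.length + 1 + 1) + 1) a m) :=
          Commute.baxter_right
            (h.commute (by omega) (by omega) (by omega) (by omega) (by omega)) _ _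
        rw [mul_assoc, ← c2.eq, ← mul_assoc, hX', smul_mul_assoc]) rfl
    exact ⟨X', by simp [strand, if_neg ha, ← mul_assoc, hX']⟩

end Divisibility

/-! ### Connectedness of the set of standard tableaux -/

section Extension

/-- A linear extension of the componentwise order of boxes. -/
def IsExt (L : List (ℕ × ℕ)) : Prop := L.Pairwise fun x y => ¬ y ≤ x

theorem IsExt.nodup {L : List (ℕ × ℕ)} (h : IsExt L) : L.Nodup :=
  List.Pairwise.imp (fun h e => h e.ge) h

/-- Linear extensions of the same set of boxes are connected by exchanges of neighbouring
incomparable boxes. -/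
theorem IsExt.induction_swap {Q : List (ℕ × ℕ) → Prop} {L L' : List (ℕ × ℕ)} (hL : IsExt L)
    (hL' : IsExt L') (hp : L.Perm L')
    (hQ : ∀ A B u v, (A ++ u :: v :: B).Perm L' → ¬ u ≤ v → ¬ v ≤ u →
      Q (A ++ u :: v :: B) → Q (A ++ v :: u :: B)) (h : Q L) : Q L' := by
  induction L' generalizing L Q with
  | nil => rwa [hp.eq_nil] at h
  | cons x L' ih =>
    obtain ⟨A, B, rfl⟩ := List.append_of_mem (hp.mem_iff.2 List.mem_cons_self)
    have hperm : (A ++ B).Perm L' :=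
      (List.perm_cons x).1 ((List.perm_middle (l₁ := A) (l₂ := B)).symm.trans hp)
    -- The first box x of the target is incomparable with everything that precedes it in L, so it
    -- can be exchanged to the front; the tails are handled by induction.
    have hmin : ∀ y ∈ A, ¬ y ≤ x ∧ ¬ x ≤ y := fun y hy =>
      ⟨(List.pairwise_cons.1 hL').1 y (hperm.mem_iff.1 (List.mem_append_left _ hy)),
        (List.pairwise_append.1 hL).2.2 y hy x List.mem_cons_self⟩
    have hfront : ∀ A B : List (ℕ × ℕ), (A ++ x :: B).Perm (x :: L') →
        (∀ y ∈ A, ¬ y ≤ x ∧ ¬ x ≤ y) → Q (A ++ x :: B) → Q (x :: (A ++ B)) := by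
      intro A
      induction A using List.reverseRecOn with
      | nil => exact fun B _ _ h => h
      | append_singleton A y ihA =>
        intro B hB hA hAB
        simp only [List.append_assoc, List.singleton_append] at hB hAB ⊢
        refine ihA (y :: B) (((List.Perm.swap y x B).append_left A).trans hB)
          (fun z hz => hA z (List.mem_append_left _ hz)) ?_
        have := hA y (by simp)
        exact hQ A B y x hB this.1 this.2 hAB
    refine ih (Q := fun M => Q (x :: M)) (L := A ++ B)
      (hL.sublist ((List.sublist_cons_self x B).append_left A)) (List.pairwise_cons.1 hL').2 hperm
      (fun C D u v hCD h1 h2 h3 => hQ (x :: C) D u v (hCD.cons x) h1 h2 h3)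
      (hfront A B hp hmin h)

end Extension

/-! ### Regularity and values on the line -/

section Values

variable {𝕜 : Type*} [Field 𝕜] {H : Type*} [Ring H] [Algebra 𝕜 H]
variable {R S : Type*} [CommRing R] [Algebra 𝕜 R] [CommRing S] [Algebra 𝕜 S]

/-- The generators after extension of scalars. -/
def extGen (R : Type*) [CommRing R] [Algebra 𝕜 R] (T : ℕ → H) (k : ℕ) : R ⊗[𝕜] H := 1 ⊗ₜ T k

theorem IsHecke.extendScalars {n : ℕ} {e : 𝕜} {T : ℕ → H} (h : IsHecke n e T) :
    IsHecke n (algebraMap 𝕜 R e) (extGen (𝕜 := 𝕜) R T) where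
  quad k h1 h2 := by
    simp [extGen, h.quad k h1 h2, TensorProduct.tmul_add,
      Algebra.TensorProduct.one_def]
  braid k h1 h2 := by simp [extGen, h.braid k h1 h2]
  comm i j h1 h2 h3 := by simp [extGen, h.comm i j h1 h2 h3]

/-- The change of scalars along a homomorphism. -/
def scalarMap (H : Type*) [Ring H] [Algebra 𝕜 H] (φ : R →ₐ[𝕜] S) : R ⊗[𝕜] H →ₐ[𝕜] S ⊗[𝕜] H :=
  Algebra.TensorProduct.map φ (AlgHom.id 𝕜 H)

/-- The evaluation of the scalars by a homomorphism to the ground field. -/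
def evalMap (H : Type*) [Ring H] [Algebra 𝕜 H] (ε : R →ₐ[𝕜] 𝕜) : R ⊗[𝕜] H →ₐ[𝕜] H :=
  (Algebra.TensorProduct.lid 𝕜 H).toAlgHom.comp (scalarMap H ε)

theorem scalarMap_smul (φ : R →ₐ[𝕜] S) (r : R) (X : R ⊗[𝕜] H) :
    scalarMap H φ (r • X) = φ r • scalarMap H φ X := by
  induction X using TensorProduct.induction_on with
  | zero => simp
  | tmul s h => simp [scalarMap, TensorProduct.smul_tmul']
  | add X Y hX hY => simp only [smul_add, map_add, hX, hY]

theorem evalMap_smul (ε : R →ₐ[𝕜] 𝕜) (r : R) (X : R ⊗[𝕜] H) :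
    evalMap H ε (r • X) = ε r • evalMap H ε X := by
  simp [evalMap, scalarMap_smul]

theorem evalMap_scalarMap (φ : R →ₐ[𝕜] S) (ε : S →ₐ[𝕜] 𝕜) (X : R ⊗[𝕜] H) :
    evalMap H ε (scalarMap H φ X) = evalMap H (ε.comp φ) X := by
  induction X using TensorProduct.induction_on with
  | zero => simp
  | tmul s h => simp [evalMap, scalarMap]
  | add X Y hX hY => simp only [map_add, hX, hY]

theorem scalarMap_baxter (φ : R →ₐ[𝕜] S) (T : ℕ → H) (e : 𝕜) (k : ℕ) (a b : R) :
    scalarMap H φ (baxter (extGen R T) (algebraMap 𝕜 R e) k a b) =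
      baxter (extGen S T) (algebraMap 𝕜 S e) k (φ a) (φ b) := by
  simp only [baxter, map_add, scalarMap_smul, map_one, map_sub, map_mul, AlgHom.commutes]
  simp [scalarMap, extGen]

theorem evalMap_baxter (ε : R →ₐ[𝕜] 𝕜) (T : ℕ → H) (e : 𝕜) (k : ℕ) (a b : R) :
    evalMap H ε (baxter (extGen R T) (algebraMap 𝕜 R e) k a b) =
      baxter T e k (ε a) (ε b) := by
  simp only [baxter, map_add, evalMap_smul, map_one, map_sub, map_mul, AlgHom.commutes]
  simp [evalMap, scalarMap, extGen]

/-- The content of a box. -/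
def content (p : ℕ × ℕ) : ℤ := (p.2 : ℤ) - p.1

/-- The weight `t^{2c} z` of a box of content `c`. -/
def weight (t : 𝕜) (z : ℕ × ℕ → R) (p : ℕ × ℕ) : R :=
  algebraMap 𝕜 R (t ^ (2 * content p)) * z p

/-- The vanishing denominator of a pair of boxes of equal content. -/
def polar (t : 𝕜) (z : ℕ × ℕ → R) (a b : ℕ × ℕ) : R :=
  if content a = content b then weight t z b - weight t z a else 1

/-- The fusion product of a sequence of boxes, with denominators cleared. -/
def word (T : ℕ → H) (t : 𝕜) (z : ℕ × ℕ → R) (L : List (ℕ × ℕ)) : R ⊗[𝕜] H :=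
  fullWord (crossing (extGen R T) (algebraMap 𝕜 R (t - t⁻¹)) (weight t z)) L

/-- After division by its vanishing denominators the fusion product is regular at `ε`, with
value `v`. -/
def HasVal (T : ℕ → H) (t : 𝕜) (ε : R →ₐ[𝕜] 𝕜) (z : ℕ × ℕ → R) (L : List (ℕ × ℕ)) (v : H) : Prop :=
  ∃ (D : R) (X : R ⊗[𝕜] H), ε D ≠ 0 ∧ D • word T t z L = pairProd (polar t z) L • X ∧
    v = (ε D)⁻¹ • evalMap H ε X

variable {T : ℕ → H} {t : 𝕜} {ε : R →ₐ[𝕜] 𝕜} {z : ℕ × ℕ → R} {L : List (ℕ × ℕ)} {n : ℕ}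

theorem map_weight (φ : R →ₐ[𝕜] S) (p : ℕ × ℕ) : φ (weight t z p) = weight t (φ ∘ z) p := by
  simp [weight]

theorem map_polar (φ : R →ₐ[𝕜] S) (a b : ℕ × ℕ) : φ (polar t z a b) = polar t (φ ∘ z) a b := by
  unfold polar; split_ifs <;> simp [map_weight]

theorem scalarMap_word (φ : R →ₐ[𝕜] S) :
    scalarMap H φ (word T t z L) = word T t (φ ∘ z) L := by
  refine (map_fullWord (scalarMap H φ : R ⊗[𝕜] H →* S ⊗[𝕜] H) _ L).trans ?_
  simp only [MonoidHom.coe_coe, crossing, scalarMap_baxter, map_weight]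
  rfl

/-- A value survives every specialization through which the evaluation point factors, so one value
can be studied with several choices of variables. -/
theorem HasVal.map {v : H} (φ : R →ₐ[𝕜] S) (ε' : S →ₐ[𝕜] 𝕜) (hε : ε'.comp φ = ε)
    (h : HasVal T t ε z L v) : HasVal T t ε' (φ ∘ z) L v := by
  obtain ⟨D, X, hD, hX, rfl⟩ := h
  have hφ : ∀ r, ε' (φ r) = ε r := fun r => by rw [← hε]; rfl
  refine ⟨φ D, scalarMap H φ X, by rwa [hφ], ?_, by rw [hφ, evalMap_scalarMap, hε]⟩
  have := congrArg (scalarMap H φ) hX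
  rw [scalarMap_smul, scalarMap_smul, scalarMap_word] at this
  rw [this]
  congr 1
  refine (map_pairProd (φ : R →* S) _ L).trans ?_
  simp only [MonoidHom.coe_coe, map_polar]

variable [IsDomain R]

/-- The polar product is a nonzero element of a domain and can be cancelled in R ⊗ H, so a relation
of the word descends to its value. -/
theorem HasVal.mul_eq_zero (hΔ : pairProd (polar t z) L ≠ 0) {v : H} (h : HasVal T t ε z L v)
    (Z : R ⊗[𝕜] H) (hZ : Z * word T t z L = 0) : evalMap H ε Z * v = 0 := by
  obtain ⟨D, X, hD, hX, rfl⟩ := h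
  have : pairProd (polar t z) L • (Z * X) = 0 := by
    rw [← mul_smul_comm, ← hX, mul_smul_comm, hZ, smul_zero]
  rw [smul_eq_zero, or_iff_right hΔ] at this
  rw [mul_smul_comm, ← map_mul, this, map_zero, smul_zero]

theorem HasVal.unique (hΔ : pairProd (polar t z) L ≠ 0) {v v' : H} (h : HasVal T t ε z L v)
    (h' : HasVal T t ε z L v') : v = v' := by
  obtain ⟨D, X, hD, hX, rfl⟩ := h
  obtain ⟨D', X', hD', hX', rfl⟩ := h'
  have : pairProd (polar t z) L • (D' • X - D • X') = 0 := by
    rw [smul_sub, smul_comm _ D', smul_comm _ D, ← hX, ← hX', smul_comm D D', sub_self]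
  rw [smul_eq_zero, or_iff_right hΔ, sub_eq_zero] at this
  have := congrArg (evalMap H ε) this
  rw [evalMap_smul, evalMap_smul] at this
  rw [inv_smul_eq_iff₀ hD, smul_comm, eq_inv_smul_iff₀ hD', this]

/-- Boxes of a diagonal carry different variables. -/
def Separates (z : ℕ × ℕ → R) : Prop :=
  ∀ p r, content p = content r → p ≠ r → z p ≠ z r

/-- Boxes of equal content have weights with the same nonzero coefficient, so their weights differ
as soon as their variables do. -/
theorem pairProd_polar_ne_zero (ht : t ≠ 0) (hz : Separates z) (hL : L.Nodup) :
    pairProd (polar t z) L ≠ 0 := by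
  refine pairProd_ne_zero (hL.imp fun {a b} hab => ?_)
  unfold polar
  split_ifs with h
  · rw [weight, weight, h, ← mul_sub, mul_ne_zero_iff, sub_ne_zero]
    exact ⟨by simpa using zpow_ne_zero _ ht, (hz a b h hab).symm⟩
  · exact one_ne_zero

end Values

/-! ### Exchange of incomparable boxes, and regularity of one tableau -/

section Swap

variable {𝕜 : Type*} [Field 𝕜] {H : Type*} [Ring H] [Algebra 𝕜 H]
variable {R : Type*} [CommRing R] [Algebra 𝕜 R]
variable {T : ℕ → H} {t : 𝕜} {ε : R →ₐ[𝕜] 𝕜} {z : ℕ × ℕ → R} {n : ℕ}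

theorem content_of_incomparable {u v : ℕ × ℕ} (h : ¬ u ≤ v) (h' : ¬ v ≤ u) :
    content u + 1 < content v ∨ content v + 1 < content u := by
  rw [Prod.le_def] at h h'
  unfold content
  omega

theorem polar_of_incomparable {u v : ℕ × ℕ} (h : ¬ u ≤ v) (h' : ¬ v ≤ u) :
    polar t z u v = 1 := by
  have := content_of_incomparable h h'
  rw [polar, if_neg]
  omega

/-- The value of the factor of two boxes where all variables are equal to one. -/
def lineFactor (T : ℕ → H) (t : 𝕜) (k : ℕ) (u v : ℕ × ℕ) : H :=
  baxter T (t - t⁻¹) k (t ^ (2 * content u)) (t ^ (2 * content v))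

theorem eval_weight (hε : ∀ p, ε (z p) = 1) (p : ℕ × ℕ) :
    ε (weight t z p) = t ^ (2 * content p) := by
  simp [weight, hε]

theorem evalMap_crossing (hε : ∀ p, ε (z p) = 1) (k : ℕ) (u v : ℕ × ℕ) :
    evalMap H ε (crossing (extGen R T) (algebraMap 𝕜 R (t - t⁻¹)) (weight t z) k u v) =
      lineFactor T t k u v := by
  rw [crossing, evalMap_baxter, eval_weight hε, eval_weight hε, lineFactor]

theorem swapScalar_ne_zero (ht : t ≠ 0) (ht' : ∀ m : ℤ, m ≠ 0 → t ^ m ≠ 1) {c d : ℤ}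
    (h : c + 1 < d ∨ d + 1 < c) :
    (t - t⁻¹) ^ 2 * t ^ (2 * c) * t ^ (2 * d) - (t ^ (2 * d) - t ^ (2 * c)) ^ 2 ≠ 0 := by
  have hne : ∀ m : ℤ, m ≠ 0 → 1 - t ^ m ≠ 0 := fun m hm => sub_ne_zero.2 (ht' m hm).symm
  -- The scalar factors so that it vanishes exactly when the contents differ by one.
  have key : (t - t⁻¹) ^ 2 * t ^ (2 * c) * t ^ (2 * d) - (t ^ (2 * d) - t ^ (2 * c)) ^ 2 =
      -(t ^ (2 * d) * (1 - t ^ (2 * (c - d) + 2))) * (t ^ (2 * d) * (1 - t ^ (2 * (c - d) - 2))) := by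
    have e1 : t ^ (2 * c) = t ^ (2 * d) * t ^ (2 * (c - d)) := by
      rw [← zpow_add₀ ht]; congr 1; ring
    rw [zpow_add₀ ht, zpow_sub₀ ht (2 * (c - d)), e1]
    generalize t ^ (2 * d) = x
    generalize t ^ (2 * (c - d)) = y
    rw [show t ^ (2 : ℤ) = t ^ 2 from by norm_cast]
    field_simp
    ring
  rw [key]
  exact mul_ne_zero (neg_ne_zero.2 (mul_ne_zero (zpow_ne_zero _ ht) (hne _ (by omega))))
    (mul_ne_zero (zpow_ne_zero _ ht) (hne _ (by omega)))

/-- Multiplying the exchange rule by the inverse crossing expresses the new word through the old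
one. The product of the two opposite crossings is a scalar that does not vanish on the line, and the
polar product is unchanged. -/
theorem HasVal.swap (hH : IsHecke n (t - t⁻¹) T) (ht : t ≠ 0) (ht' : ∀ m : ℤ, m ≠ 0 → t ^ m ≠ 1)
    (hε : ∀ p, ε (z p) = 1) {A B : List (ℕ × ℕ)} {u v : ℕ × ℕ}
    (hn : A.length + B.length + 2 ≤ n) (huv : ¬ u ≤ v) (hvu : ¬ v ≤ u) {x : H}
    (hx : HasVal T t ε z (A ++ u :: v :: B) x) :
    ∃ c : 𝕜, HasVal T t ε z (A ++ v :: u :: B)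
      (c • (lineFactor T t (A.length + 1) v u * x * lineFactor T t (B.length + 1) v u)) := by
  obtain ⟨D, X, hD, hX, rfl⟩ := hx
  have hR := hH.extendScalars (R := R)
  set s : R := algebraMap 𝕜 R (t - t⁻¹) ^ 2 * weight t z v * weight t z u -
    (weight t z u - weight t z v) ^ 2 with hs
  have hsε : ε s ≠ 0 := by
    simp only [hs, map_sub, map_mul, map_pow, AlgHom.commutes, eval_weight hε]
    exact swapScalar_ne_zero ht ht' (content_of_incomparable hvu huv)
  have hsm := baxter_mul_swap hR (k := A.length + 1) (by omega) (by omega) (weight t z v)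
    (weight t z u)
  have hcr := crossing_mul_fullWord (weight t z) hR A B u v hn
  set F := crossing (extGen (𝕜 := 𝕜) R T) (algebraMap 𝕜 R (t - t⁻¹)) (weight t z)
  change F (A.length + 1) v u * F (A.length + 1) u v = s • 1 at hsm
  refine ⟨(ε s)⁻¹, s * D, F (A.length + 1) v u * X * F (B.length + 1) v u,
    by rw [map_mul]; exact mul_ne_zero hsε hD, ?_, ?_⟩
  · rw [← pairProd_swap _ _ _ _ _ ((polar_of_incomparable huv hvu).trans
      (polar_of_incomparable hvu huv).symm), ← smul_mul_assoc, ← mul_smul_comm, ← hX,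
      mul_smul_comm, smul_mul_assoc, mul_assoc, mul_comm s, mul_smul]
    congr 1
    change _ = _ * (fullWord F _ * _)
    rw [← hcr, ← mul_assoc, hsm, smul_mul_assoc, one_mul, word]
  · simp only [map_mul, F, evalMap_crossing hε, smul_mul_assoc, mul_smul_comm, smul_smul, mul_inv]

variable [IsDomain R]

/-- The fusion product is regular for sequences in which every box is immediately followed by a
neighbour with the same variable, unless it is the last one of its diagonal. -/
theorem exists_word_eq_smul (hH : IsHecke n (t - t⁻¹) T) (ht : t ≠ 0) (hz : Separates z)
    (L : List (ℕ × ℕ)) (hL : L.Nodup) (hn : L.length ≤ n)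
    (hnext : ∀ A p C m D, L = A ++ p :: (C ++ m :: D) → content p = content m →
      ∃ r C', C = r :: C' ∧ z r = z p ∧ (content r = content p + 1 ∨ content r = content p - 1)) :
    ∃ X, word T t z L = pairProd (polar t z) L • X := by
  have hR := hH.extendScalars (R := R)
  induction L using List.reverseRecOn with
  | nil => exact ⟨1, by simp [word, fullWord, braidFrom, pairProd]⟩
  | append_singleton L m ih =>
    have hL' : L.Nodup := (List.nodup_append.1 hL).1
    simp only [List.length_append, List.length_singleton] at hn
    obtain ⟨X, hX⟩ := ih hL' (by omega) fun A p C m' D hA hc =>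
      hnext A p C m' (D ++ [m]) (by simp [hA]) hc
    -- X is the shorter word divided by its polar product; it inherits the right eigenvector
    -- relations by torsion-freeness.
    obtain ⟨X', hX'⟩ := exists_mul_strand (weight t z) hR m (fun p => content p = content m) L
      (by omega) X (by
        rintro A p C rfl hp
        obtain ⟨r, C', rfl, hr, hc⟩ := hnext A p C m [] (by simp) hp
        have hlen : A.length + C'.length + 2 ≤ n := by
          simp only [List.length_append, List.length_cons] at hn; omega
        have hΔ := pairProd_polar_ne_zero ht hz hL'
        have main : ∀ σ σ' : 𝕜, σ * σ' = 1 → t - t⁻¹ = σ - σ' →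
            t ^ (2 * content r) = σ ^ 2 * t ^ (2 * content p) →
            algebraMap 𝕜 R σ * algebraMap 𝕜 R σ' = 1 ∧
            algebraMap 𝕜 R (t - t⁻¹) = algebraMap 𝕜 R σ - algebraMap 𝕜 R σ' ∧
            weight t z r = algebraMap 𝕜 R σ ^ 2 * weight t z p ∧
            X * extGen R T (C'.length + 1) = algebraMap 𝕜 R σ • X := by
          intro σ σ' h1 h2 h3
          have h1' : algebraMap 𝕜 R σ * algebraMap 𝕜 R σ' = 1 := by rw [← map_mul, h1, map_one]
          have h2' : algebraMap 𝕜 R (t - t⁻¹) = algebraMap 𝕜 R σ - algebraMap 𝕜 R σ' := by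
            rw [h2, map_sub]
          have h3' : weight t z r = algebraMap 𝕜 R σ ^ 2 * weight t z p := by
            rw [weight, weight, h3, map_mul, map_pow, hr]; ring
          refine ⟨h1', h2', h3', ?_⟩
          have := fullWord_mul_gen (weight t z) hR h1' h2' A C' p r hlen h3'
          change word T t z _ * _ = _ • word T t z _ at this
          rw [hX, smul_mul_assoc, smul_comm, ← sub_eq_zero, ← smul_sub, smul_eq_zero,
            or_iff_right hΔ, sub_eq_zero] at this
          exact this
        rcases hc with hc | hc
        -- A neighbour of larger content gives σ = t, one of smaller content σ = -t⁻¹.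
        · refine ⟨r, C', _, _, rfl, by omega, main t t⁻¹ (mul_inv_cancel₀ ht) rfl ?_⟩
          rw [hc, mul_add, zpow_add₀ ht, mul_comm]
          norm_cast
        · refine ⟨r, C', _, _, rfl, by omega, main (-t⁻¹) (-t) (by simp [ht]) (by ring) ?_⟩
          rw [hc, mul_sub, zpow_sub₀ ht, neg_sq, inv_pow, div_eq_mul_inv, mul_comm]
          norm_cast)
    refine ⟨X', ?_⟩
    rw [pairProd_concat, mul_smul]
    change fullWord _ _ = pairProd (polar t z) L • (L.map fun p =>
      if content p = content m then weight t z m - weight t z p else 1).prod • X'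
    rw [← hX', fullWord_concat, ← smul_mul_assoc, ← hX]
    rfl

end Swap

/-! ### The tableau filled hook by hook -/

section Canonical

/-- The boxes of the `h`-th principal hook of a large square, the arm before the leg. -/
def hookList (N h : ℕ) : List (ℕ × ℕ) :=
  (List.range N).map (fun j => (h, h + j)) ++ (List.range N).map fun j => (h + 1 + j, h)

/-- The principal hooks of a large square, one after the other. -/
def hooksList (N : ℕ) : List (ℕ × ℕ) := (List.range N).flatMap (hookList N)

theorem isExt_hooksList (N : ℕ) : IsExt (hooksList N) := by
  rw [IsExt, hooksList, List.pairwise_flatMap]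
  constructor
  · intro h _
    rw [hookList, List.pairwise_append, List.pairwise_map, List.pairwise_map]
    refine ⟨List.pairwise_lt_range.imp ?_, List.pairwise_lt_range.imp ?_, ?_⟩
    · intro a b hab; simp only [Prod.mk_le_mk]; omega
    · intro a b hab; simp only [Prod.mk_le_mk]; omega
    · simp only [List.mem_map, List.mem_range]
      rintro _ ⟨a, _, rfl⟩ _ ⟨b, _, rfl⟩
      simp only [Prod.mk_le_mk]; omega
  · refine List.pairwise_lt_range.imp fun {h h'} hh x hx y hy => ?_
    simp only [hookList, List.mem_append, List.mem_map, List.mem_range] at hx hy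
    rcases hx with ⟨a, _, rfl⟩ | ⟨a, _, rfl⟩ <;> rcases hy with ⟨b, _, rfl⟩ | ⟨b, _, rfl⟩ <;>
      simp only [Prod.mk_le_mk] <;> omega

theorem mem_hooksList {N a b : ℕ} (ha : a < N) (hb : b < N) : (a, b) ∈ hooksList N := by
  simp only [hooksList, List.mem_flatMap, hookList, List.mem_append, List.mem_map, List.mem_range,
    Prod.mk.injEq]
  rcases le_or_gt a b with h | h
  · exact ⟨a, ha, Or.inl ⟨b - a, by omega, rfl, by omega⟩⟩
  · exact ⟨b, hb, Or.inr ⟨a - b - 1, by omega, by omega, rfl⟩⟩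

/-- The box following in the same arm or leg. -/
def nextBox (p : ℕ × ℕ) : ℕ × ℕ := if p.1 ≤ p.2 then (p.1, p.2 + 1) else (p.1 + 1, p.2)

theorem infix_range {N j : ℕ} (h : j + 1 < N) : [j, j + 1] <:+: List.range N := by
  obtain ⟨d, rfl⟩ := Nat.exists_eq_add_of_le h
  refine ⟨List.range j, (List.range d).map (j + 1 + 1 + ·), ?_⟩
  rw [List.range_add, List.range_succ, List.range_succ]
  simp

theorem infix_hooksList {N : ℕ} {p : ℕ × ℕ} (h1 : p.1 + 1 < N) (h2 : p.2 + 1 < N) :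
    [p, nextBox p] <:+: hooksList N := by
  have hin : ∀ h, h < N → hookList N h <:+: hooksList N := by
    intro h hh
    obtain ⟨A, B, hAB⟩ := List.append_of_mem (List.mem_range.2 hh)
    exact ⟨A.flatMap (hookList N), B.flatMap (hookList N), by simp [hooksList, hAB]⟩
  obtain ⟨a, b⟩ := p
  dsimp only at h1 h2
  rcases le_or_gt a b with h | h
  · refine List.IsInfix.trans ?_ (hin a (by omega))
    have := (infix_range (N := N) (j := b - a) (by omega)).map fun j => (a, a + j)
    refine List.IsInfix.trans ?_ (this.trans (List.prefix_append _ _).isInfix)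
    simp only [nextBox, if_pos h, List.map_cons, List.map_nil]
    rw [show a + (b - a) = b by omega, show a + (b - a + 1) = b + 1 by omega]
  · refine List.IsInfix.trans ?_ (hin b (by omega))
    have := (infix_range (N := N) (j := a - b - 1) (by omega)).map fun j => (b + 1 + j, b)
    refine List.IsInfix.trans ?_ (this.trans (List.suffix_append _ _).isInfix)
    simp only [nextBox, if_neg h.not_ge, List.map_cons, List.map_nil]
    rw [show b + 1 + (a - b - 1) = a by omega, show b + 1 + (a - b - 1 + 1) = a + 1 by omega]

/-- The boxes of a Young diagram, hook by hook. -/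
def hookTableau (μ : YoungDiagram) : List (ℕ × ℕ) :=
  -- Any square containing μ with room to spare would do.
  (hooksList (μ.rowLen 0 + μ.colLen 0)).filter fun p => decide (p ∈ μ)

theorem lt_of_mem_diagram {μ : YoungDiagram} {p : ℕ × ℕ} (h : p ∈ μ) :
    p.1 < μ.rowLen 0 + μ.colLen 0 ∧ p.2 < μ.rowLen 0 + μ.colLen 0 := by
  obtain ⟨a, b⟩ := p
  have h1 := YoungDiagram.mem_iff_lt_colLen.1 (μ.up_left_mem le_rfl (Nat.zero_le b) h)
  have h2 := YoungDiagram.mem_iff_lt_rowLen.1 (μ.up_left_mem (Nat.zero_le a) le_rfl h)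
  dsimp only
  omega

theorem isExt_hookTableau (μ : YoungDiagram) : IsExt (hookTableau μ) :=
  (isExt_hooksList _).sublist List.filter_sublist

theorem mem_hookTableau {μ : YoungDiagram} {p : ℕ × ℕ} : p ∈ hookTableau μ ↔ p ∈ μ := by
  rw [hookTableau, List.mem_filter, decide_eq_true_iff, and_iff_right_iff_imp]
  exact fun h => mem_hooksList (lt_of_mem_diagram h).1 (lt_of_mem_diagram h).2

/-- A later box m on the diagonal of p forces p + (1, 1) into μ, hence also the next box of the arm
or leg. The two are adjacent in the large square, and filtering keeps them adjacent. -/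
theorem next_hookTableau {μ : YoungDiagram} {A C D : List (ℕ × ℕ)} {p m : ℕ × ℕ}
    (h : hookTableau μ = A ++ p :: (C ++ m :: D)) (hc : content p = content m) :
    ∃ C', C = nextBox p :: C' := by
  have hext := isExt_hookTableau μ
  have hm : m ∈ μ := mem_hookTableau.1 (by simp [h])
  have hmp : ¬ m ≤ p := by
    rw [h] at hext
    exact (List.pairwise_cons.1 (List.pairwise_append.1 hext).2.1).1 m (by simp)
  have hp : p.1 + 1 ≤ m.1 ∧ p.2 + 1 ≤ m.2 := by
    rw [Prod.le_def] at hmp; unfold content at hc; omega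
  have hp1 : (p.1 + 1, p.2 + 1) ∈ μ := μ.up_left_mem hp.1 hp.2 hm
  have hlt := lt_of_mem_diagram hp1
  have hnext : nextBox p ∈ μ := by
    unfold nextBox; split_ifs
    · exact μ.up_left_mem (Nat.le_succ _) le_rfl hp1
    · exact μ.up_left_mem le_rfl (Nat.le_succ _) hp1
  have hpm : p ∈ μ := μ.up_left_mem (Nat.le_succ _) (Nat.le_succ _) hp1
  obtain ⟨A', D', hAD⟩ := (infix_hooksList hlt.1 hlt.2).filter fun p => decide (p ∈ μ)
  change _ = hookTableau μ at hAD
  rw [List.filter_cons_of_pos (by simpa using hpm), List.filter_cons_of_pos (by simpa using hnext),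
    List.filter_nil, h, List.append_assoc] at hAD
  have hnd := hext.nodup
  have hnd' := hnd
  rw [h] at hnd
  rw [h, ← hAD] at hnd'
  have := (List.append_cons_inj_of_notMem (a₁ := p) (a₂ := p)
    (fun hx => (List.nodup_append.1 hnd').2.2 p hx p (by simp) rfl)
    (List.nodup_cons.1 (List.nodup_append.1 hnd').2.1).1).1 hAD
  have hCD : nextBox p :: D' = C ++ m :: D := this.2.2
  -- If C were empty, m would be the next box itself, which is not strictly below and to the right
  -- of p.
  rcases C with _ | ⟨r, C⟩
  · simp only [List.nil_append, List.cons.injEq] at hCD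
    rw [← hCD.1] at hp
    unfold nextBox at hp
    split_ifs at hp <;> simp at hp
  · simp only [List.cons_append, List.cons.injEq] at hCD
    exact ⟨C, by rw [hCD.1]⟩

end Canonical

/-! ### Existence of values with arms and legs separated -/

section Existence

variable {𝕜 : Type*} [Field 𝕜] {H : Type*} [Ring H] [Algebra 𝕜 H]
variable {T : ℕ → H} {t : 𝕜} {n : ℕ}

/-- Independent variables for the arms (with the corner) and the legs of the principal hooks. -/
noncomputable def splitVar (𝕜 : Type*) [Field 𝕜] (p : ℕ × ℕ) : MvPolynomial (ℕ ⊕ ℕ) 𝕜 :=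
  if p.1 ≤ p.2 then MvPolynomial.X (Sum.inl p.1) else MvPolynomial.X (Sum.inr p.2)

/-- The evaluation at the point all of whose coordinates are one. -/
noncomputable def evalOne (𝕜 S : Type*) [Field 𝕜] : MvPolynomial S 𝕜 →ₐ[𝕜] 𝕜 :=
  MvPolynomial.aeval fun _ => 1

theorem evalOne_splitVar (p : ℕ × ℕ) : evalOne 𝕜 _ (splitVar 𝕜 p) = 1 := by
  unfold splitVar evalOne; split_ifs <;> simp

/-- A diagonal meets only arms or only legs, and each hook at most once. -/
theorem separates_splitVar : Separates (splitVar 𝕜) := by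
  rintro ⟨a, b⟩ ⟨c, d⟩ h hne
  rw [Ne, Prod.mk.injEq] at hne
  unfold content at h
  unfold splitVar
  dsimp only at *
  split_ifs <;> rw [Ne, MvPolynomial.X_inj] <;> simp <;> omega

/-- The sequence of boxes of a standard tableau of shape `μ`. -/
def IsTableau (μ : YoungDiagram) (L : List (ℕ × ℕ)) : Prop :=
  IsExt L ∧ ∀ p, p ∈ L ↔ p ∈ μ

theorem IsTableau.perm {μ : YoungDiagram} {L L' : List (ℕ × ℕ)} (h : IsTableau μ L)
    (h' : IsTableau μ L') : L.Perm L' :=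
  (List.perm_ext_iff_of_nodup h.1.nodup h'.1.nodup).2 fun p => (h.2 p).trans (h'.2 p).symm

theorem IsTableau.length {μ : YoungDiagram} {L : List (ℕ × ℕ)} (h : IsTableau μ L) :
    L.length = μ.card := by
  have : L.toFinset = μ.cells := by ext p; simp [h.2]
  rw [YoungDiagram.card, ← this, List.toFinset_card_of_nodup h.1.nodup]

theorem isTableau_hookTableau (μ : YoungDiagram) : IsTableau μ (hookTableau μ) :=
  ⟨isExt_hookTableau μ, fun _ => mem_hookTableau⟩

theorem exists_hasVal {μ : YoungDiagram} (hH : IsHecke μ.card (t - t⁻¹) T) (ht : t ≠ 0)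
    (ht' : ∀ m : ℤ, m ≠ 0 → t ^ m ≠ 1) {L : List (ℕ × ℕ)} (hL : IsTableau μ L) :
    ∃ v, HasVal T t (evalOne 𝕜 _) (splitVar 𝕜) L v := by
  have h0 := isTableau_hookTableau μ
  refine h0.1.induction_swap (Q := fun L => ∃ v, HasVal T t (evalOne 𝕜 _) (splitVar 𝕜) L v) hL.1
    (h0.perm hL) ?_ ?_
  · rintro A B u v hp huv hvu ⟨x, hx⟩
    have hlen := hp.length_eq
    rw [hL.length] at hlen
    simp only [List.length_append, List.length_cons] at hlen
    obtain ⟨c, hc⟩ := hx.swap hH ht ht' evalOne_splitVar (by omega) huv hvu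
    exact ⟨_, hc⟩
  · obtain ⟨X, hX⟩ := exists_word_eq_smul hH ht (separates_splitVar (𝕜 := 𝕜)) (hookTableau μ) h0.1.nodup
      h0.length.le fun A p C m D h hc => by
        obtain ⟨C', hC'⟩ := next_hookTableau h hc
        refine ⟨_, C', hC', ?_, ?_⟩
        · unfold nextBox splitVar
          split_ifs <;> simp_all <;> omega
        · unfold nextBox content
          split_ifs
          · left; push_cast; ring
          · right; push_cast; ring
    exact ⟨_, 1, X, by simp, by rw [one_smul, hX], rfl⟩

end Existence

/-! ### Identification of variables -/

section Specialize

variable {𝕜 : Type*} [Field 𝕜]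

/-- One variable for every principal hook. -/
noncomputable def hookVar (𝕜 : Type*) [Field 𝕜] (p : ℕ × ℕ) : MvPolynomial ℕ 𝕜 :=
  MvPolynomial.X (min p.1 p.2)

/-- The variables of arm and leg of each hook are identified. -/
noncomputable def mergeHooks (𝕜 : Type*) [Field 𝕜] :
    MvPolynomial (ℕ ⊕ ℕ) 𝕜 →ₐ[𝕜] MvPolynomial ℕ 𝕜 :=
  MvPolynomial.aeval (Sum.elim MvPolynomial.X MvPolynomial.X)

/-- The variable of the leg of the hook `b` is identified with that of the next arm. -/
noncomputable def mergeLeg (𝕜 : Type*) [Field 𝕜] (b : ℕ) :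
    MvPolynomial (ℕ ⊕ ℕ) 𝕜 →ₐ[𝕜] MvPolynomial (ℕ ⊕ ℕ) 𝕜 :=
  MvPolynomial.aeval (Sum.elim (fun h => MvPolynomial.X (Sum.inl h))
    fun h => if h = b then MvPolynomial.X (Sum.inl (b + 1)) else MvPolynomial.X (Sum.inr h))

theorem evalOne_mergeHooks : (evalOne 𝕜 ℕ).comp (mergeHooks 𝕜) = evalOne 𝕜 (ℕ ⊕ ℕ) := by
  ext i; rcases i with i | i <;> simp [evalOne, mergeHooks]

theorem evalOne_mergeLeg (b : ℕ) :
    (evalOne 𝕜 (ℕ ⊕ ℕ)).comp (mergeLeg 𝕜 b) = evalOne 𝕜 (ℕ ⊕ ℕ) := by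
  ext i; rcases i with i | i
  · simp [evalOne, mergeLeg]
  · by_cases h : i = b <;> simp [evalOne, mergeLeg, h]

theorem mergeHooks_splitVar : mergeHooks 𝕜 ∘ splitVar 𝕜 = hookVar 𝕜 := by
  funext p
  simp only [Function.comp_apply, splitVar, hookVar, mergeHooks]
  split_ifs with h
  · simp [min_eq_left h]
  · simp [min_eq_right (not_le.1 h).le]

theorem separates_hookVar : Separates (hookVar 𝕜) := by
  rintro ⟨a, b⟩ ⟨c, d⟩ h hne
  rw [Ne, Prod.mk.injEq] at hne
  unfold content at h
  unfold hookVar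
  dsimp only at *
  rw [Ne, MvPolynomial.X_inj]
  omega

/-- Legs have negative content and arms nonnegative content, so identifying a leg with an arm never
affects two boxes of one diagonal. -/
theorem separates_mergeLeg (b : ℕ) : Separates (mergeLeg 𝕜 b ∘ splitVar 𝕜) := by
  rintro ⟨a, c⟩ ⟨d, e⟩ h hne
  rw [Ne, Prod.mk.injEq] at hne
  unfold content at h
  unfold splitVar mergeLeg
  dsimp only [Function.comp_apply] at *
  split_ifs with h1 h2 <;> simp only [MvPolynomial.aeval_X, Sum.elim_inl, Sum.elim_inr] <;>
    (try split_ifs) <;> rw [Ne, MvPolynomial.X_inj] <;> simp <;> omega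

end Specialize

/-! ### Annihilation for neighbours in a row -/

section Kill

variable {𝕜 : Type*} [Field 𝕜] {H : Type*} [Ring H] [Algebra 𝕜 H]
variable {R : Type*} [CommRing R] [Algebra 𝕜 R]
variable {T : ℕ → H} {t : 𝕜} {ε : R →ₐ[𝕜] 𝕜} {z : ℕ × ℕ → R} {n : ℕ}

theorem weight_step (ht : t ≠ 0) {u v : ℕ × ℕ} (hz : z u = z v) :
    (content v = content u + 1 →
      weight t z v = algebraMap 𝕜 R t ^ 2 * weight t z u) ∧
    (content v = content u - 1 →
      weight t z v = algebraMap 𝕜 R (-t⁻¹) ^ 2 * weight t z u) := by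
  constructor <;> intro h <;> rw [weight, weight, h, ← map_pow, ← mul_assoc, ← map_mul, hz] <;>
    congr 2
  · rw [mul_add, zpow_add₀ ht, mul_comm]; norm_cast
  · rw [mul_sub, zpow_sub₀ ht, neg_sq, inv_pow, div_eq_mul_inv, mul_comm]; norm_cast

theorem zpow_step (ht : t ≠ 0) {c d : ℤ} :
    (d = c + 1 → t ^ (2 * d) = t ^ 2 * t ^ (2 * c)) ∧
    (d = c - 1 → t ^ (2 * d) = (-t⁻¹) ^ 2 * t ^ (2 * c)) := by
  constructor <;> rintro rfl
  · rw [mul_add, zpow_add₀ ht, mul_comm]; norm_cast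
  · rw [mul_sub, zpow_sub₀ ht, neg_sq, inv_pow, div_eq_mul_inv, mul_comm]; norm_cast

theorem evalMap_gen_sub (σ : 𝕜) (k : ℕ) :
    evalMap H ε (extGen R T k - algebraMap 𝕜 R σ • 1) = T k - σ • 1 := by
  rw [map_sub, evalMap_smul, map_one, AlgHom.commutes]
  simp [evalMap, scalarMap, extGen]

variable [IsDomain R]

theorem HasVal.gen_sub_mul_eq_zero (hH : IsHecke n (t - t⁻¹) T) (ht : t ≠ 0) (hz : Separates z)
    {A E : List (ℕ × ℕ)} {u v : ℕ × ℕ} (hnd : (A ++ u :: v :: E).Nodup)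
    (hn : (A ++ u :: v :: E).length ≤ n) (hzuv : z u = z v) (hc : content v = content u + 1)
    {x : H} (hx : HasVal T t ε z (A ++ u :: v :: E) x) :
    (T (A.length + 1) - t • 1) * x = 0 := by
  have hR := hH.extendScalars (R := R)
  simp only [List.length_append, List.length_cons] at hn
  rw [← evalMap_gen_sub (ε := ε)]
  refine hx.mul_eq_zero (pairProd_polar_ne_zero ht hz hnd) _ ?_
  exact gen_sub_mul_fullWord (weight t z) hR (σ' := algebraMap 𝕜 R t⁻¹)
    (by rw [← map_mul, mul_inv_cancel₀ ht, map_one]) (by rw [map_sub]) A E u v (by omega)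
    ((weight_step ht hzuv).1 hc)

theorem HasVal.kill_swap (hH : IsHecke n (t - t⁻¹) T) (ht : t ≠ 0)
    (ht' : ∀ m : ℤ, m ≠ 0 → t ^ m ≠ 1) (hε : ∀ p, ε (z p) = 1) (hz : Separates z)
    {A B : List (ℕ × ℕ)} {u v : ℕ × ℕ} (hnd : (A ++ u :: v :: B).Nodup)
    (hn : (A ++ u :: v :: B).length ≤ n) (huv : ¬ u ≤ v) (hvu : ¬ v ≤ u) {k : ℕ} (hk : 1 ≤ k)
    (hkn : k < n) (hkA : k < A.length ∨ A.length + 2 < k)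
    (h : ∀ x, HasVal T t ε z (A ++ u :: v :: B) x → (T k - t • 1) * x = 0) {x : H}
    (hx : HasVal T t ε z (A ++ v :: u :: B) x) : (T k - t • 1) * x = 0 := by
  simp only [List.length_append, List.length_cons] at hn
  -- Exchanging there and back writes x, by uniqueness, as a multiple of a crossing times the
  -- annihilated value times a crossing; the left crossing commutes with T_k.
  obtain ⟨c, hc⟩ := hx.swap hH ht ht' hε (by omega) hvu huv
  obtain ⟨d, hd⟩ := hc.swap hH ht ht' hε (by omega) huv hvu
  have hnd' : (A ++ v :: u :: B).Nodup :=
    ((List.Perm.swap v u B).append_left A).nodup_iff.1 hnd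
  have h0 := h _ hc
  rw [hx.unique (pairProd_polar_ne_zero ht hz hnd') hd]
  have hcomm : Commute (T k - t • (1 : H)) (lineFactor T t (A.length + 1) v u) :=
    (Commute.baxter_right (hH.commute hk (by omega) hkn (by omega) (by omega)) _ _).sub_left
      ((Commute.one_left _).smul_left t)
  rw [mul_smul_comm, ← mul_assoc, ← mul_assoc, hcomm.eq, mul_assoc (lineFactor T t _ v u), h0]
  simp

/-- Moving w across the pair u, v and back presents x through the value y of A u v w B. As y is an
eigenvector, it may be replaced by a multiple of the crossing of u and v applied to it, and
Yang–Baxter carries this crossing to the left, with index raised by one. -/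
theorem HasVal.kill_move (hH : IsHecke n (t - t⁻¹) T) (ht : t ≠ 0)
    (ht' : ∀ m : ℤ, m ≠ 0 → t ^ m ≠ 1) (ht2 : t + t⁻¹ ≠ 0) (hε : ∀ p, ε (z p) = 1)
    (hz : Separates z) {A B : List (ℕ × ℕ)} {u v w : ℕ × ℕ}
    (hnd : (A ++ w :: u :: v :: B).Nodup) (hn : (A ++ w :: u :: v :: B).length ≤ n)
    (huw : ¬ u ≤ w) (hwu : ¬ w ≤ u) (hvw : ¬ v ≤ w) (hwv : ¬ w ≤ v)
    (huv : content v = content u + 1)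
    (h : ∀ x, HasVal T t ε z (A ++ u :: v :: w :: B) x → (T (A.length + 1) - t • 1) * x = 0) {x : H}
    (hx : HasVal T t ε z (A ++ w :: u :: v :: B) x) : (T (A.length + 2) - t • 1) * x = 0 := by
  simp only [List.length_append, List.length_cons] at hn
  obtain ⟨c, h1⟩ := hx.swap hH ht ht' hε (by simp only [List.length_cons]; omega) hwu huw
  rw [← List.singleton_append, ← List.append_assoc] at h1
  obtain ⟨y, h2⟩ : ∃ y, HasVal T t ε z ((A ++ [u]) ++ v :: w :: B) y := by
    obtain ⟨d, h2⟩ := h1.swap hH ht ht' hε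
      (by simp only [List.length_append, List.length_singleton]; omega) hwv hvw
    exact ⟨_, h2⟩
  have h0 := h _ (by simpa using h2)
  obtain ⟨c', h3⟩ := h2.swap hH ht ht' hε
    (by simp only [List.length_append, List.length_singleton]; omega) hvw hwv
  rw [List.append_assoc, List.singleton_append] at h3
  obtain ⟨d', h4⟩ := h3.swap hH ht ht' hε (by simp only [List.length_cons]; omega) huw hwu
  rw [hx.unique (pairProd_polar_ne_zero ht hz hnd) h4]
  clear h1 h2 h3 h4
  simp only [List.length_append, List.length_cons, List.length_nil, zero_add]
  have hu := baxter_of_eq (T := T) (mul_inv_cancel₀ ht) rfl (A.length + 1)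
    ((zpow_step ht).1 huv)
  have hu' := baxter_of_eq (T := T) (mul_inv_cancel₀ ht) rfl (A.length + 1 + 1)
    ((zpow_step ht).1 huv)
  set s : 𝕜 := (t ^ 2 - 1) * t ^ (2 * content u)
  have hs : s ≠ 0 := mul_ne_zero (sub_ne_zero.2 (by exact_mod_cast ht' 2 (by norm_num)))
    (zpow_ne_zero _ ht)
  have hy : T (A.length + 1) * y = t • y := by
    rw [sub_mul, smul_mul_assoc, one_mul, sub_eq_zero] at h0; exact h0
  have hy' : lineFactor T t (A.length + 1) u v * y = (s * (t + t⁻¹)) • y := by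
    rw [lineFactor, hu, smul_mul_assoc, add_mul, hy, smul_mul_assoc, one_mul, ← add_smul, smul_smul]
  have yb := yangBaxter hH (k := A.length + 1) (by omega) (by omega) (t ^ (2 * content w))
    (t ^ (2 * content u)) (t ^ (2 * content v))
  rw [hu'] at yb
  change lineFactor T t _ w u * lineFactor T t _ w v * lineFactor T t _ u v =
    _ * lineFactor T t _ w v * lineFactor T t _ w u at yb
  have key : (T (A.length + 1 + 1) - t • 1) *
      (lineFactor T t (A.length + 1) w u * lineFactor T t (A.length + 1 + 1) w v * y) = 0 := by
    have : (s * (t + t⁻¹)) • ((T (A.length + 1 + 1) - t • 1) *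
        (lineFactor T t (A.length + 1) w u * lineFactor T t (A.length + 1 + 1) w v * y)) = 0 := by
      rw [← mul_smul_comm, ← mul_smul_comm, ← hy', ← mul_assoc _ _ y, yb]
      simp only [smul_mul_assoc, mul_smul_comm, ← mul_assoc]
      rw [hH.sub_mul_add (mul_inv_cancel₀ ht) rfl (by omega) (by omega)]
      simp
    exact (smul_eq_zero.1 this).resolve_left (mul_ne_zero hs ht2)
  rw [show A.length + 2 = A.length + 1 + 1 from rfl]
  simp only [mul_smul_comm, smul_mul_assoc, mul_assoc] at key ⊢
  simp only [← mul_assoc] at key ⊢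
  rw [key]
  simp

variable {μ : YoungDiagram}

theorem braid_eq_zero (hH : IsHecke n (t - t⁻¹) T) (ht : t ≠ 0) (ht2 : t + t⁻¹ ≠ 0) {k : ℕ}
    (hk : 1 ≤ k) (hkn : k + 1 < n) {x : H} (h1 : T k * x = t • x)
    (h2 : T (k + 1) * x = (-t⁻¹) • x) : x = 0 := by
  have hb := congrArg (· * x) (hH.braid k hk hkn)
  simp only [mul_assoc, h1, h2, mul_smul_comm, smul_smul] at hb
  rw [← sub_eq_zero, ← sub_smul, smul_eq_zero] at hb
  refine hb.resolve_left ?_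
  rw [show t * (-t⁻¹ * t) - -t⁻¹ * (t * -t⁻¹) = -(t + t⁻¹) by field_simp; ring]
  exact neg_ne_zero.2 ht2

theorem HasVal.hook {L : List (ℕ × ℕ)} {x : H}
    (hx : HasVal T t (evalOne 𝕜 _) (splitVar 𝕜) L x) :
    HasVal T t (evalOne 𝕜 _) (hookVar 𝕜) L x := by
  have := hx.map (mergeHooks 𝕜) (evalOne 𝕜 ℕ) evalOne_mergeHooks
  rwa [mergeHooks_splitVar] at this

/-- Arm pairs and the pair from a leg to the next corner have equal variables after a separating
specialization. For two legs, the tableau is rearranged so that the 2 × 2 square p0, r0, x0, y0 is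
filled consecutively, and the row above gives the induction hypothesis. -/
theorem gen_sub_mul_of_row (hH : IsHecke μ.card (t - t⁻¹) T) (ht : t ≠ 0)
    (ht' : ∀ m : ℤ, m ≠ 0 → t ^ m ≠ 1) (ht2 : t + t⁻¹ ≠ 0) (a b : ℕ) (A E : List (ℕ × ℕ))
    (hL : IsTableau μ (A ++ (a, b) :: (a, b + 1) :: E)) (x : H)
    (hx : HasVal T t (evalOne 𝕜 _) (splitVar 𝕜) (A ++ (a, b) :: (a, b + 1) :: E) x) :
    (T (A.length + 1) - t • 1) * x = 0 := by
  have hcont : ∀ a b : ℕ, content (a, b + 1) = content (a, b) + 1 := by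
    intro a b; unfold content; push_cast; ring
  induction a generalizing A E x with
  | zero =>
    exact hx.gen_sub_mul_eq_zero hH ht separates_splitVar hL.1.nodup hL.length.le
      (by simp [splitVar]) (hcont _ _)
  | succ a ih =>
    rcases lt_trichotomy a b with hab | hab | hab
    · exact hx.gen_sub_mul_eq_zero hH ht separates_splitVar hL.1.nodup hL.length.le
        (by simp only [splitVar]; rw [if_pos (by omega), if_pos (by omega)]) (hcont _ _)
    -- Here the pair goes from the leg of hook a to the corner of hook a + 1.
    · subst hab
      have := hx.map (mergeLeg 𝕜 a) (evalOne 𝕜 _) (evalOne_mergeLeg a)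
      exact this.gen_sub_mul_eq_zero hH ht (separates_mergeLeg a) hL.1.nodup hL.length.le
        (by simp [splitVar, mergeLeg]) (hcont _ _)
    have hμ : (a + 1, b + 1) ∈ μ := (hL.2 _).1 (by simp)
    set x0 : ℕ × ℕ := (a + 1, b) with hx0
    set y0 : ℕ × ℕ := (a + 1, b + 1) with hy0
    set p0 : ℕ × ℕ := (a, b) with hp0
    set r0 : ℕ × ℕ := (a, b + 1) with hr0
    have hsplit := List.pairwise_append.1 hL.1
    have hbefore : ∀ w, w ≤ y0 → w ≠ x0 → w ≠ y0 → w ∈ A := by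
      intro w hw h1 h2
      have hmem : w ∈ A ++ x0 :: y0 :: E := (hL.2 w).2 (μ.up_left_mem hw.1 hw.2 hμ)
      simp only [List.mem_append, List.mem_cons, h1, h2, false_or] at hmem
      refine hmem.resolve_right fun hE => ?_
      exact (List.pairwise_cons.1 (List.pairwise_cons.1 hsplit.2.1).2).1 w hE hw
    -- D holds the boxes that must precede the square, F those that can be postponed until after it.
    set D := A.filter fun w => decide (w ≤ y0 ∧ w ≠ p0 ∧ w ≠ r0) with hD
    set F := A.filter fun w => decide (¬ w ≤ y0) with hF
    have hDmem : ∀ w, w ∈ D ↔ w ∈ A ∧ w ≤ y0 ∧ w ≠ p0 ∧ w ≠ r0 := by intro w; simp [hD]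
    have hFmem : ∀ w, w ∈ F ↔ w ∈ A ∧ ¬ w ≤ y0 := by intro w; simp [hF]
    have hA : ∀ w ∈ A, ¬ x0 ≤ w ∧ ¬ y0 ≤ w := fun w hw =>
      ⟨hsplit.2.2 w hw x0 (by simp), hsplit.2.2 w hw y0 (by simp)⟩
    have hpA : p0 ∈ A := hbefore _ (by simp [p0, y0]) (by simp [p0, x0]) (by simp [p0, y0])
    have hrA : r0 ∈ A := hbefore _ (by simp [r0, y0]) (by simp [r0, x0]) (by simp [r0, y0])
    have hDF : IsExt (D ++ p0 :: r0 :: F) := by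
      have e1 : IsExt D := hsplit.1.sublist List.filter_sublist
      have e2 : IsExt F := hsplit.1.sublist List.filter_sublist
      rw [IsExt, List.pairwise_append, List.pairwise_cons, List.pairwise_cons]
      refine ⟨e1, ⟨?_, ?_, e2⟩, ?_⟩
      · simp only [List.mem_cons]
        rintro w (rfl | hw) hle
        · simp [r0, p0] at hle
        · exact ((hFmem w).1 hw).2 (hle.trans (by simp [p0, y0]))
      · intro w hw hle
        exact ((hFmem w).1 hw).2 (hle.trans (by simp [r0, y0]))
      -- The interval from p0 to y0 is the 2 × 2 square, whose lower boxes x0, y0 are not in A.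
      · intro d hd w hw hle
        obtain ⟨hdA, hdy, hdp, hdr⟩ := (hDmem d).1 hd
        have hdx := hA d hdA
        simp only [List.mem_cons] at hw
        obtain ⟨i, j⟩ := d
        rcases hw with rfl | rfl | hw
        · simp only [p0, r0, x0, y0, Prod.mk_le_mk, Ne, Prod.mk.injEq] at *
          omega
        · simp only [p0, r0, x0, y0, Prod.mk_le_mk, Ne, Prod.mk.injEq] at *
          omega
        · exact ((hFmem w).1 hw).2 (hle.trans hdy)
    have hperm : (D ++ p0 :: r0 :: F).Perm A := by
      refine (List.perm_ext_iff_of_nodup hDF.nodup (IsExt.nodup hsplit.1)).2 fun w => ?_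
      simp only [List.mem_append, List.mem_cons, hDmem, hFmem]
      constructor
      · rintro (h | rfl | rfl | h)
        exacts [h.1, hpA, hrA, h.1]
      · intro h
        tauto
    have hnd := hL.1.nodup
    have hlen := hL.length
    -- transport along permutations of the boxes before `x0`
    suffices hmain : ∀ x, HasVal T t (evalOne 𝕜 _) (splitVar 𝕜)
        ((D ++ p0 :: r0 :: F) ++ x0 :: y0 :: E) x →
        (T ((D ++ p0 :: r0 :: F).length + 1) - t • 1) * x = 0 by
      refine IsExt.induction_swap (Q := fun M => ∀ x, HasVal T t (evalOne 𝕜 _) (splitVar 𝕜)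
        (M ++ x0 :: y0 :: E) x → (T (M.length + 1) - t • 1) * x = 0) hDF hsplit.1 hperm ?_ hmain x hx
      intro B C u v hBC huv hvu h x hx
      have hBC' := hBC.append_right (x0 :: y0 :: E)
      have hl := hBC'.length_eq
      rw [hlen] at hl
      rw [List.append_assoc, List.cons_append, List.cons_append] at hx hBC'
      refine hx.kill_swap hH ht ht' evalOne_splitVar separates_splitVar (hBC'.nodup_iff.2 hnd)
        (by rw [hBC'.length_eq, hlen]) huv hvu (by omega) ?_ (Or.inr ?_) ?_
      · simp only [List.length_append, List.length_cons] at hl ⊢; omega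
      · simp only [List.length_append, List.length_cons]; omega
      · intro x hx
        have := h x (by simpa using hx)
        simpa [List.length_append] using this
    have hperm' := hperm.append_right (x0 :: y0 :: E)
    -- transport along moves of boxes across `x0`, `y0`
    suffices hmain : ∀ x, HasVal T t (evalOne 𝕜 _) (splitVar 𝕜)
        (D ++ p0 :: r0 :: x0 :: y0 :: (F ++ E)) x →
        (T (D.length + 3) - t • 1) * x = 0 by
      have hmove : ∀ G G', F = G ++ G' → ∀ x, HasVal T t (evalOne 𝕜 _) (splitVar 𝕜)
          ((D ++ p0 :: r0 :: G) ++ x0 :: y0 :: (G' ++ E)) x →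
          (T ((D ++ p0 :: r0 :: G).length + 1) - t • 1) * x = 0 := by
        intro G
        induction G using List.reverseRecOn with
        | nil =>
          rintro G' hG x hx
          rw [List.nil_append] at hG
          have := hmain x (by simpa [hG] using hx)
          simpa using this
        | append_singleton G w ihG =>
          intro G' hG x hx
          have hw : w ∈ F := by simp [hG]
          obtain ⟨hwA, hwy⟩ := (hFmem w).1 hw
          have hwA' := hA w hwA
          have hP : ((D ++ p0 :: r0 :: G) ++ w :: x0 :: y0 :: (G' ++ E)).Perm
              (A ++ x0 :: y0 :: E) := by
            refine List.Perm.trans ?_ hperm'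
            rw [hG]
            simp only [List.append_assoc, List.cons_append, List.nil_append]
            refine List.Perm.append_left _ (List.Perm.cons _ (List.Perm.cons _ ?_))
            refine List.Perm.append_left _ (List.Perm.cons _ ?_)
            exact (List.perm_append_comm (l₁ := [x0, y0]) (l₂ := G')).append_right E |>.trans
              (by simp)
          have := HasVal.kill_move (A := D ++ p0 :: r0 :: G) (B := G' ++ E) (w := w) (u := x0)
            (v := y0) (x := x) hH ht ht' ht2 (ε := evalOne 𝕜 _) evalOne_splitVar separates_splitVar
            (hP.nodup_iff.2 hnd) (by rw [hP.length_eq, hlen]) hwA'.1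
            (fun h => hwy (h.trans (by simp [x0, y0]))) hwA'.2 hwy (hcont _ _)
            (fun x hx => ihG (w :: G') (by simp [hG]) x hx) (by simpa using hx)
          simpa [add_assoc] using this
      exact hmove F [] (by simp)
    clear hx x
    intro x hx
    set L := D ++ p0 :: r0 :: x0 :: y0 :: (F ++ E) with hLdef
    have hLperm : L.Perm (A ++ x0 :: y0 :: E) := by
      refine List.Perm.trans ?_ hperm'
      simp only [hLdef, List.append_assoc, List.cons_append]
      refine List.Perm.append_left _ (List.Perm.cons _ (List.Perm.cons _ ?_))
      exact (List.perm_append_comm (l₁ := [x0, y0]) (l₂ := F)).append_right E |>.trans (by simp)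
    have hLext : IsExt L := by
      have e0 : IsExt (x0 :: y0 :: E) := hsplit.2.1
      have e1 := List.pairwise_append.1 hDF
      have e2 := List.pairwise_append.1 (show IsExt ([p0, r0] ++ F) from e1.2.1)
      have e3 := List.pairwise_cons.1 e0
      have e4 := List.pairwise_cons.1 e3.2
      have eF : IsExt (F ++ E) := List.pairwise_append.2 ⟨e2.2.1, e4.2, fun w hw e he =>
        hsplit.2.2 w ((hFmem w).1 hw).1 e (by simp [he])⟩
      have eyF : IsExt (y0 :: (F ++ E)) := by
        refine List.pairwise_cons.2 ⟨fun w hw => ?_, eF⟩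
        rcases List.mem_append.1 hw with hw | hw
        · exact ((hFmem w).1 hw).2
        · exact e4.1 w hw
      have exF : IsExt (x0 :: y0 :: (F ++ E)) := by
        refine List.pairwise_cons.2 ⟨fun w hw => ?_, eyF⟩
        rcases List.mem_cons.1 hw with rfl | hw
        · exact e3.1 _ (by simp)
        rcases List.mem_append.1 hw with hw | hw
        · exact fun h => ((hFmem w).1 hw).2 (h.trans (by simp [x0, y0]))
        · exact e3.1 w (by simp [hw])
      have eA : IsExt (D ++ [p0, r0]) := hDF.sublist (by simp)
      have : IsExt ((D ++ [p0, r0]) ++ x0 :: y0 :: (F ++ E)) := by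
        refine List.pairwise_append.2 ⟨eA, exF, fun d hd w hw => ?_⟩
        have hdA : d ∈ A := by
          simp only [List.mem_append, List.mem_cons, List.not_mem_nil, or_false] at hd
          rcases hd with hd | rfl | rfl
          exacts [((hDmem d).1 hd).1, hpA, hrA]
        have hdy : d ≤ y0 := by
          simp only [List.mem_append, List.mem_cons, List.not_mem_nil, or_false] at hd
          rcases hd with hd | rfl | rfl
          exacts [((hDmem d).1 hd).2.1, by simp [p0, y0], by simp [r0, y0]]
        simp only [List.mem_cons, List.mem_append] at hw
        rcases hw with rfl | rfl | hw | hw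
        · exact (hA d hdA).1
        · exact (hA d hdA).2
        · exact fun h => ((hFmem w).1 hw).2 (h.trans hdy)
        · exact hsplit.2.2 d hdA w (by simp [hw])
      simpa [hLdef] using this
    have hLtab : IsTableau μ L := ⟨hLext, fun w => hLperm.mem_iff.trans (hL.2 w)⟩
    have hLlen := hLtab.length
    have h1 := ih D (x0 :: y0 :: (F ++ E)) hLtab x hx
    have hn : D.length + 4 ≤ μ.card := by
      rw [← hLlen, hLdef]; simp only [List.length_append, List.length_cons]; omega
    rw [sub_mul, smul_mul_assoc, one_mul, sub_eq_zero] at h1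
    -- the generator between `r0` and `x0`
    have hxh := hx.hook
    have hR := hH.extendScalars (R := MvPolynomial ℕ 𝕜)
    have hσ : (-t⁻¹) * (-t) = 1 := by simp [ht]
    have he : t - t⁻¹ = (-t⁻¹) - (-t) := by ring
    have hyx : content x0 = content y0 - 1 := by rw [hx0, hy0, hcont]; ring
    -- With x0 and y0 exchanged, r0 is followed by the box y0 below it, in the same hook since b <
    -- a. The word of this sequence, not a standard one, is annihilated by T + t⁻¹, and the exchange
    -- rule carries the relation back to L.
    have h2 : (T (D.length + 2) - (-t⁻¹) • 1) * lineFactor T t (D.length + 3) y0 x0 * x = 0 := by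
      have hlen2 : (D ++ [p0, r0]).length + (F ++ E).length + 2 ≤ μ.card := by
        rw [← hLlen, hLdef]; simp only [List.length_append, List.length_cons, List.length_nil]; omega
      have e1 := crossing_mul_fullWord (weight t (hookVar 𝕜)) hR (D ++ [p0, r0]) (F ++ E) y0 x0
        hlen2
      have hlen3 : (D ++ [p0]).length + (x0 :: (F ++ E)).length + 2 ≤ μ.card := by
        rw [← hLlen, hLdef]; simp only [List.length_append, List.length_cons, List.length_nil]; omega
      have e2 := gen_sub_mul_fullWord (weight t (hookVar 𝕜)) hR
        (σ := algebraMap 𝕜 _ (-t⁻¹)) (σ' := algebraMap 𝕜 _ (-t))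
        (by rw [← map_mul, hσ, map_one]) (by rw [← map_sub, ← he]) (D ++ [p0])
        (x0 :: (F ++ E)) r0 y0 hlen3
        ((weight_step ht (by simp only [hookVar, r0, y0]; congr 1; omega)).2
          (by simp only [r0, y0, content]; push_cast; ring))
      simp only [List.append_assoc, List.cons_append, List.nil_append, List.length_append,
        List.length_cons, List.length_nil, zero_add] at e1 e2
      have := hxh.mul_eq_zero (pairProd_polar_ne_zero ht separates_hookVar hLext.nodup)
        ((extGen _ T (D.length + 2) - algebraMap 𝕜 (MvPolynomial ℕ 𝕜) (-t⁻¹) • 1) *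
          crossing (extGen _ T) (algebraMap 𝕜 _ (t - t⁻¹)) (weight t (hookVar 𝕜))
            (D.length + 3) y0 x0) (by
          rw [mul_assoc]
          change _ * (_ * fullWord _ (D ++ p0 :: r0 :: x0 :: y0 :: (F ++ E))) = 0
          rw [e1, ← mul_assoc, e2, zero_mul])
      rwa [map_mul, evalMap_gen_sub, evalMap_crossing (fun p => by simp [evalOne, hookVar])] at this
    rw [lineFactor, baxter_of_eq (T := T) hσ he _ ((zpow_step ht).2 hyx), mul_smul_comm,
      smul_mul_assoc, smul_eq_zero, or_iff_right] at h2
    · have hT : (T (D.length + 3) + -t • (1 : H)) * x = (T (D.length + 3) - t • 1) * x := by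
        rw [neg_smul, sub_eq_add_neg]
      rw [mul_assoc, hT, sub_mul, smul_mul_assoc, one_mul, sub_eq_zero] at h2
      -- The vector (T_{d+3} - t) x, where d = |D|, has eigenvalue t under T_{d+1} by induction and
      -- -t⁻¹ under T_{d+2}; the braid relation excludes this unless it is zero.
      refine braid_eq_zero hH ht ht2 (k := D.length + 1) (by omega) (by omega) ?_ h2
      have hc : Commute (T (D.length + 1)) (T (D.length + 3) - t • (1 : H)) :=
        (hH.commute (by omega) (by omega) (by omega) (by omega) (by omega)).sub_right
          ((Commute.one_right _).smul_right t)
      rw [← mul_assoc, hc.eq, mul_assoc, h1, mul_smul_comm]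
    · refine mul_ne_zero (sub_ne_zero.2 ?_) (zpow_ne_zero _ ht)
      rw [neg_sq, inv_pow, Ne, inv_eq_one]
      exact_mod_cast ht' 2 (by norm_num)

end Kill

/-! ### The product over ordered pairs as a word -/

section Lists

variable {α M : Type*} [Monoid M]

theorem strand_congr {g g' : ℕ → α → α → M} {s : ℕ} {L : List α} {u : α}
    (h : ∀ a ∈ L, ∀ k, g k a u = g' k a u) : strand g s L u = strand g' s L u := by
  induction L with
  | nil => rfl
  | cons a L ih =>
    rw [strand, strand, h a (by simp), ih fun b hb => h b (by simp [hb])]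

theorem fullWord_congr {g g' : ℕ → α → α → M} {L : List α}
    (h : L.Pairwise fun a b => ∀ k, g k a b = g' k a b) : fullWord g L = fullWord g' L := by
  induction L using List.reverseRecOn with
  | nil => rfl
  | append_singleton L u ih =>
    obtain ⟨h1, -, h2⟩ := List.pairwise_append.1 h
    rw [fullWord_concat, fullWord_concat, ih h1,
      strand_congr fun a ha k => h2 a ha u (List.mem_singleton_self u) k]

theorem pairProd_comp {β R : Type*} [CommMonoid R] (s : α → α → R) (w : β → α) (L : List β) :
    pairProd (fun a b => s (w a) (w b)) L = pairProd s (L.map w) := by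
  induction L with
  | nil => rfl
  | cons a L ih => simp [pairProd, ih, Function.comp_def]

theorem strand_ofFn (g : ℕ → α → α → M) {n : ℕ} (f : Fin n → α) (u : α) :
    strand g 0 (List.ofFn f) u = (List.ofFn fun i => g (n - i) (f i) u).prod := by
  induction n with
  | zero => simp [strand]
  | succ n ih => simp [List.ofFn_succ, strand, ih]

theorem prod_orderedPairs {n : ℕ} (g : ℕ → Fin n → Fin n → M) :
    ((HookFusion.orderedPairs n).map fun p => g ((p.2 : ℕ) - (p.1 : ℕ)) p.1 p.2).prod =
      fullWord g (List.finRange n) := by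
  induction n with
  | zero => rfl
  | succ n ih =>
    have e : HookFusion.orderedPairs (n + 1) =
        (HookFusion.orderedPairs n).map (Prod.map Fin.castSucc Fin.castSucc) ++
          (List.finRange n).map fun i => (i.castSucc, Fin.last n) := by
      simp only [HookFusion.orderedPairs, List.finRange_succ_last, List.flatMap_append,
        List.flatMap_map, List.map_flatMap, List.flatMap_singleton, List.filter_append,
        List.filter_map, List.map_append, List.map_map]
      congr 1
      · refine List.flatMap_congr fun j _ => ?_
        simp [Function.comp_def, Fin.not_lt.2 (Fin.le_last _)]
      · simp [Function.comp_def, Fin.castSucc_lt_last]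
    have h2 : ((List.finRange n).map fun i : Fin n => g (n - (i : ℕ)) i.castSucc (Fin.last n)).prod =
        strand g 0 ((List.finRange n).map Fin.castSucc) (Fin.last n) := by
      rw [← List.ofFn_eq_map, ← List.ofFn_eq_map, strand_ofFn]
    rw [e, List.map_append, List.prod_append, List.finRange_succ_last, fullWord_concat, ← h2,
      ← fullWord_comp, ← ih]
    simp [Function.comp_def]

end Lists

/-! ### Transposition of tableaux -/

section Transpose

variable {𝕜 : Type*} [Field 𝕜] {H : Type*} [Ring H] [Algebra 𝕜 H] {T : ℕ → H}

theorem isTableau_transpose {μ : YoungDiagram} {L : List (ℕ × ℕ)} (h : IsTableau μ L) :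
    IsTableau μ.transpose (L.map Prod.swap) := by
  refine ⟨List.pairwise_map.2 (h.1.imp fun {p r} hpr => ?_), fun p => ?_⟩
  · rwa [Prod.swap_le_swap]
  · rw [YoungDiagram.mem_transpose, ← h.2, List.mem_map]
    exact ⟨by rintro ⟨r, hr, rfl⟩; simpa using hr, fun hp => ⟨_, hp, by simp⟩⟩

/-- Transposition negates contents, which replacing t by -t⁻¹ undoes in t^{2c}, while t - t⁻¹ is
unchanged: both words are literally the same. -/
theorem HasVal.transpose {R : Type*} [CommRing R] [Algebra 𝕜 R] {t : 𝕜} {ε : R →ₐ[𝕜] 𝕜}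
    {z : ℕ × ℕ → R} {L : List (ℕ × ℕ)} {x : H} (h : HasVal T (-t⁻¹) ε z (L.map Prod.swap) x) :
    HasVal T t ε (z ∘ Prod.swap) L x := by
  obtain ⟨D, X, hD, hX, rfl⟩ := h
  have hc : ∀ p : ℕ × ℕ, content p.swap = -content p := fun p => by
    simp [content]
  have hw : ∀ p : ℕ × ℕ, weight (-t⁻¹) z p.swap = weight t (z ∘ Prod.swap) p := fun p => by
    rw [weight, weight, hc, mul_neg, Even.neg_zpow (by simp), inv_zpow, zpow_neg, inv_inv]
    rfl
  refine ⟨D, X, hD, ?_, rfl⟩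
  have e : -t⁻¹ - (-t⁻¹)⁻¹ = t - t⁻¹ := by rw [inv_neg, inv_inv]; ring
  have h1 : word T (-t⁻¹) z (L.map Prod.swap) = word T t (z ∘ Prod.swap) L := by
    rw [word, word, ← fullWord_comp, e]
    simp only [crossing, hw]
    rfl
  have h2 : pairProd (polar (-t⁻¹) z) (L.map Prod.swap) =
      pairProd (polar t (z ∘ Prod.swap)) L := by
    rw [← pairProd_comp]
    simp only [polar, hw, hc, neg_inj]
    rfl
  rw [← h1, hX, h2]

end Transpose

/-! ### Box sequences of tableaux, and the Hecke algebra over ℂ(q) -/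

section Tableau

open HookFusion

variable {μ : YoungDiagram} (Λ : StandardTableau μ)

/-- The boxes of a standard tableau in the order of their entries. -/
def boxes : List (ℕ × ℕ) := List.ofFn Λ.box

theorem fill_le_fill {p r : ℕ × ℕ} (hp : p ∈ μ) (hr : r ∈ μ) (h : p ≤ r) :
    Λ.fill ⟨p, hp⟩ ≤ Λ.fill ⟨r, hr⟩ := by
  obtain ⟨a, b⟩ := p
  obtain ⟨c, d⟩ := r
  obtain ⟨h1, h2⟩ := h
  dsimp only at h1 h2
  have hm : (a, d) ∈ μ := μ.up_left_mem h1 le_rfl hr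
  refine le_trans (b := Λ.fill ⟨(a, d), hm⟩) ?_ ?_
  · rcases h2.eq_or_lt with rfl | h2
    · exact le_rfl
    · exact (Λ.row_strict a b d hp hm h2).le
  · rcases h1.eq_or_lt with rfl | h1
    · exact le_rfl
    · exact (Λ.col_strict a c d hm hr h1).le

theorem isTableau_boxes : IsTableau μ (boxes Λ) := by
  constructor
  · rw [IsExt, boxes, List.pairwise_ofFn]
    intro i j hij hle
    have := fill_le_fill Λ (Λ.fill.symm j).2 (Λ.fill.symm i).2 hle
    simp only [Subtype.coe_eta, Equiv.apply_symm_apply] at this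
    exact absurd hij this.not_gt
  · intro p
    rw [boxes, List.mem_ofFn]
    constructor
    · rintro ⟨i, rfl⟩
      exact (Λ.fill.symm i).2
    · intro hp
      exact ⟨Λ.fill ⟨p, hp⟩, by simp [StandardTableau.box]⟩

theorem exists_boxes_eq {p r : ℕ × ℕ} (hp : p ∈ μ) (hr : r ∈ μ) {k : ℕ} (hk : Λ.entry p hp = k)
    (hk' : Λ.entry r hr = k + 1) :
    ∃ A E, boxes Λ = A ++ p :: r :: E ∧ A.length + 1 = k := by
  unfold StandardTableau.entry at hk hk'
  have hbox : ∀ p (hp : p ∈ μ), Λ.box (Λ.fill ⟨p, hp⟩) = p := by simp [StandardTableau.box]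
  have hget : ∀ p (hp : p ∈ μ), (boxes Λ)[(Λ.fill ⟨p, hp⟩ : ℕ)]? = some p := fun p hp => by
    simp [boxes, hbox]
  have h1 := hget p hp
  have h2 := hget r hr
  set i : ℕ := (Λ.fill ⟨p, hp⟩ : ℕ)
  rw [show (Λ.fill ⟨r, hr⟩ : ℕ) = i + 1 by omega] at h2
  obtain ⟨hi1, h1⟩ := List.getElem?_eq_some_iff.1 h1
  obtain ⟨hi2, h2⟩ := List.getElem?_eq_some_iff.1 h2
  refine ⟨(boxes Λ).take i, (boxes Λ).drop (i + 2), ?_, ?_⟩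
  · conv_lhs => rw [← List.take_append_drop i (boxes Λ), List.drop_eq_getElem_cons hi1,
      List.drop_eq_getElem_cons hi2, h1, h2]
  · rw [List.length_take, min_eq_left hi1.le, hk]

theorem mul_self_of_sub_mul_add {𝕜 H : Type*} [Field 𝕜] [Ring H] [Algebra 𝕜 H] {t : 𝕜}
    (ht : t ≠ 0) {x : H} (h : (x - algebraMap 𝕜 H t) * (x + algebraMap 𝕜 H t⁻¹) = 0) :
    x * x = (t - t⁻¹) • x + 1 := by
  have h1 : (t * t⁻¹) • (1 : H) = 1 := by rw [mul_inv_cancel₀ ht, one_smul]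
  simp only [Algebra.algebraMap_eq_smul_one, sub_mul, mul_add, smul_mul_assoc, mul_smul_comm,
    one_mul, mul_one] at h
  linear_combination (norm := module) h + h1

theorem q_ne_zero : q ≠ 0 := RatFunc.X_ne_zero

theorem isHecke_T (n : ℕ) : IsHecke n (q - q⁻¹) (HookFusion.T n) where
  quad k h1 h2 := by
    have := RingQuot.mkAlgHom_rel K (HeckeRel.quadratic (n := n) ⟨k, h1, h2⟩)
    have hT : HookFusion.T n k = HeckeAlgebra.mk n (FreeAlgebra.ι K (⟨k, h1, h2⟩ : GenIndex n)) :=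
      dif_pos ⟨h1, h2⟩
    change HeckeAlgebra.mk n _ = HeckeAlgebra.mk n _ at this
    rw [map_mul, map_sub, map_add, map_zero, AlgHom.commutes, AlgHom.commutes, ← hT] at this
    exact mul_self_of_sub_mul_add q_ne_zero this
  braid k h1 h2 := by
    have := RingQuot.mkAlgHom_rel K
      (HeckeRel.braid (n := n) ⟨k, h1, by omega⟩ ⟨k + 1, by omega, h2⟩ rfl)
    change HeckeAlgebra.mk n _ = HeckeAlgebra.mk n _ at this
    simp only [map_mul] at this
    rw [HookFusion.T, HookFusion.T, dif_pos ⟨h1, by omega⟩, dif_pos ⟨by omega, h2⟩]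
    exact this
  comm i j h1 h2 h3 := by
    have := RingQuot.mkAlgHom_rel K
      (HeckeRel.comm (n := n) ⟨i, h1, by omega⟩ ⟨j, by omega, h3⟩ h2)
    change HeckeAlgebra.mk n _ = HeckeAlgebra.mk n _ at this
    simp only [map_mul] at this
    rw [HookFusion.T, HookFusion.T, dif_pos ⟨h1, by omega⟩, dif_pos ⟨by omega, h3⟩]
    exact this

theorem q_zpow_ne_one (m : ℤ) (hm : m ≠ 0) : q ^ m ≠ 1 := by
  have hnat : ∀ k : ℕ, k ≠ 0 → q ^ k ≠ 1 := by
    intro k hk h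
    rw [q, ← RatFunc.algebraMap_X, ← map_pow, ← map_one (algebraMap (Polynomial ℂ) _)] at h
    have := congrArg Polynomial.natDegree (RatFunc.algebraMap_injective ℂ h)
    simp [hk] at this
  obtain ⟨k, rfl | rfl⟩ := m.eq_nat_or_neg
  · rw [zpow_natCast]; exact hnat k (by omega)
  · rw [zpow_neg, zpow_natCast, Ne, inv_eq_one]; exact hnat k (by omega)

theorem q_add_inv_ne_zero : q + q⁻¹ ≠ 0 := by
  intro h
  have h2 : q ^ 2 = -1 := by
    have := congrArg (· * q) h
    simp only [add_mul, inv_mul_cancel₀ q_ne_zero, zero_mul] at this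
    linear_combination this
  refine q_zpow_ne_one 4 (by norm_num) ?_
  have : q ^ 4 = 1 := by rw [show q ^ 4 = (q ^ 2) ^ 2 by ring, h2]; norm_num
  exact_mod_cast this

end Tableau

/-! ### The value, its annihilators, and divisibility -/

section Values

variable {𝕜 : Type*} [Field 𝕜] {H : Type*} [Ring H] [Algebra 𝕜 H] {T : ℕ → H} {t : 𝕜}
variable {μ : YoungDiagram}

theorem card_transpose (μ : YoungDiagram) : μ.transpose.card = μ.card := by
  have h := isTableau_hookTableau μ
  rw [← h.length, ← (isTableau_transpose h).length, List.length_map]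

theorem exists_value (hH : IsHecke μ.card (t - t⁻¹) T) (ht : t ≠ 0)
    (ht' : ∀ m : ℤ, m ≠ 0 → t ^ m ≠ 1) (ht2 : t + t⁻¹ ≠ 0) {L : List (ℕ × ℕ)}
    (hL : IsTableau μ L) :
    ∃ v, HasVal T t (evalOne 𝕜 ℕ) (hookVar 𝕜) L v ∧
      (∀ a b A E, L = A ++ (a, b) :: (a, b + 1) :: E → (T (A.length + 1) - t • 1) * v = 0) ∧
      (∀ a b A E, L = A ++ (a, b) :: (a + 1, b) :: E →
        (T (A.length + 1) - (-t⁻¹) • 1) * v = 0) := by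
  have e : -t⁻¹ - (-t⁻¹)⁻¹ = t - t⁻¹ := by rw [inv_neg, inv_inv]; ring
  have hH' : IsHecke μ.transpose.card (-t⁻¹ - (-t⁻¹)⁻¹) T := by
    rw [e, card_transpose]; exact hH
  have hq' : -t⁻¹ ≠ 0 := neg_ne_zero.2 (inv_ne_zero ht)
  have hz' : ∀ m : ℤ, m ≠ 0 → (-t⁻¹) ^ m ≠ 1 := by
    intro m hm h
    have h2 : ((-t⁻¹) ^ m) ^ 2 = 1 := by rw [h, one_pow]
    rw [← zpow_natCast, ← zpow_mul, Even.neg_zpow (by simp), inv_zpow, inv_eq_one] at h2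
    exact ht' _ (by simpa using hm) h2
  have hs' : -t⁻¹ + (-t⁻¹)⁻¹ ≠ 0 := by
    rw [inv_neg, inv_inv, ← neg_add, add_comm]; exact neg_ne_zero.2 ht2
  have hLt := isTableau_transpose hL
  obtain ⟨v, hv⟩ := exists_hasVal hH ht ht' hL
  obtain ⟨v', hv'⟩ := exists_hasVal hH' hq' hz' hLt
  have hswap : hookVar 𝕜 ∘ Prod.swap = hookVar 𝕜 := by
    funext p; simp [hookVar, min_comm]
  have h := hv'.hook.transpose
  rw [hswap] at h
  -- The splitting into arms and legs is not symmetric, since the diagonal belongs to the arms; the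
  -- two values are compared with one variable per hook, where transposition is harmless.
  have hvv := hv.hook.unique (pairProd_polar_ne_zero ht separates_hookVar hL.1.nodup) h
  refine ⟨v, hv.hook, fun a b A E hE => ?_, fun a b A E hE => ?_⟩
  · rw [hE] at hL hv
    exact gen_sub_mul_of_row hH ht ht' ht2 a b A E hL v hv
  · rw [hE] at hLt hv'
    simp only [List.map_append, List.map_cons, Prod.swap_prod_mk] at hLt hv'
    have := gen_sub_mul_of_row hH' hq' hz' hs' b a _ _ hLt v' hv'
    rwa [List.length_map, ← hvv] at this

theorem eq_of_zpow_eq (ht : t ≠ 0) (ht' : ∀ m : ℤ, m ≠ 0 → t ^ m ≠ 1) {c d : ℤ}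
    (h : t ^ (2 * c) = t ^ (2 * d)) : c = d := by
  by_contra hcd
  refine ht' (2 * c - 2 * d) (by omega) ?_
  rw [zpow_sub₀ ht, h, div_self (zpow_ne_zero _ ht)]

/-- On an eigenvector v for t, the element x - s acts as the invertible scalar t - s. -/
theorem exists_eq_mul {s : 𝕜} (hts : t ≠ s) {x v : H} (h : (x - t • 1) * v = 0) :
    ∃ y, v = (x - algebraMap 𝕜 H s) * y := by
  refine ⟨(t - s)⁻¹ • v, ?_⟩
  have hx : x * v = t • v := by
    rwa [sub_mul, smul_mul_assoc, one_mul, sub_eq_zero] at h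
  rw [mul_smul_comm, sub_mul, hx, ← Algebra.smul_def, ← sub_smul, smul_smul,
    inv_mul_cancel₀ (sub_ne_zero.2 hts), one_smul]

theorem algHom_pairProd {α R S : Type*} [CommRing R] [CommRing S] [Algebra 𝕜 R] [Algebra 𝕜 S]
    (φ : R →ₐ[𝕜] S) (s : α → α → R) (L : List α) :
    φ (pairProd s L) = pairProd (fun a b => φ (s a b)) L :=
  map_pairProd (φ : R →* S) s L

theorem baxter_coeff {a b c e : 𝕜} (hc : c ≠ 0) (ha : a ≠ 0) (hab : c * b - c * a ≠ 0) :
    e * (c * a) = (c * b - c * a) * (e / (a⁻¹ * b - 1)) := by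
  have hba : b - a ≠ 0 := by
    intro h; apply hab; rw [← mul_sub, h, mul_zero]
  have : a⁻¹ * b - 1 = a⁻¹ * (b - a) := by
    rw [mul_sub, inv_mul_cancel₀ ha]
  rw [this]
  field_simp

/-- The denominator of a pair of boxes of different contents. -/
def regularPart {R : Type*} [CommRing R] [Algebra 𝕜 R] (t : 𝕜) (z : ℕ × ℕ → R)
    (a b : ℕ × ℕ) : R :=
  if content a = content b then 1 else weight t z b - weight t z a

theorem polar_mul_regularPart {R : Type*} [CommRing R] [Algebra 𝕜 R] (t : 𝕜)
    (z : ℕ × ℕ → R) (a b : ℕ × ℕ) :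
    polar t z a b * regularPart t z a b = weight t z b - weight t z a := by
  unfold polar regularPart
  split_ifs <;> simp

end Values

/-! ### Return to the fusion product -/

section Fusion

open HookFusion

variable {μ : YoungDiagram} (Λ : StandardTableau μ)

/-- The value of the product of the denominators of all pairs of boxes of different contents. -/
noncomputable def lineDenominator : K :=
  pairProd (fun a b => if content a = content b then 1 else
    q ^ (2 * content b) - q ^ (2 * content a)) (boxes Λ)

theorem lineDenominator_ne_zero : lineDenominator Λ ≠ 0 := by
  refine pairProd_ne_zero (List.pairwise_of_forall fun a b => ?_)
  split_ifs with h
  · exact one_ne_zero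
  · exact sub_ne_zero.2 fun h' => h (eq_of_zpow_eq q_ne_zero q_zpow_ne_one h').symm

variable {S : Type} {n : ℕ}

/-- The inclusion of polynomials into rational functions. -/
noncomputable def toField (S : Type) : MvPolynomial S K →ₐ[K] RatField S :=
  IsScalarTower.toAlgHom K (MvPolynomial S K) (RatField S)

theorem toField_injective : Function.Injective (toField S) :=
  IsFractionRing.injective (MvPolynomial S K) (RatField S)

theorem toRat_eq (N : HeckePoly S n) :
    HeckePoly.toRat N = scalarMap (HeckeAlgebra n) (toField S) N := rfl

theorem toRat_injective : Function.Injective (HeckePoly.toRat (S := S) (n := n)) :=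
  Module.Flat.rTensor_preserves_injective_linearMap _ toField_injective

theorem eval_eq (y : S → K) (N : HeckePoly S n) :
    HeckePoly.eval y N = evalMap (HeckeAlgebra n) (MvPolynomial.aeval y) N := rfl

theorem IsRegularWithValue.unique {f : HeckeRat S n} {y : S → K} {v v' : HeckeAlgebra n}
    (h : IsRegularWithValue f y v) (h' : IsRegularWithValue f y v') : v = v' := by
  obtain ⟨N, D, hD, hN, rfl⟩ := h
  obtain ⟨N', D', hD', hN', rfl⟩ := h'
  have : D' • N = D • N' := by
    apply toRat_injective
    rw [toRat_eq, toRat_eq, scalarMap_smul, scalarMap_smul, ← toRat_eq, ← toRat_eq, ← hN, ← hN']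
    exact smul_comm _ _ _
  have := congrArg (evalMap (HeckeAlgebra n) (MvPolynomial.aeval y)) this
  rw [evalMap_smul, evalMap_smul, ← eval_eq, ← eval_eq, MvPolynomial.aeval_eq_eval] at this
  rw [inv_smul_eq_iff₀ hD, smul_comm, eq_inv_smul_iff₀ hD']
  exact this

/-- The variables of the principal hooks of `μ`, divided by `c`. -/
noncomputable def scaledHooks (μ : YoungDiagram) (c : K) :
    MvPolynomial ℕ K →ₐ[K] MvPolynomial (PrincipalHook μ) K :=
  MvPolynomial.aeval fun h =>
    -- Indices of no hook of μ get 1, so that every variable evaluates to 1 at the point (c, …, c).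
    if hh : (h, h) ∈ μ then MvPolynomial.C c⁻¹ * MvPolynomial.X ⟨h, hh⟩ else 1

theorem aeval_scaledHooks {c : K} (hc : c ≠ 0) :
    (MvPolynomial.aeval fun _ => c : MvPolynomial (PrincipalHook μ) K →ₐ[K] K).comp
      (scaledHooks μ c) = evalOne K ℕ := by
  ext h
  by_cases hh : (h, h) ∈ μ <;> simp [scaledHooks, evalOne, hh, hc]

theorem toField_weight (c : K) (i : Fin μ.card) :
    toField _ (weight q (scaledHooks μ c ∘ hookVar K) (Λ.box i)) =
      algebraMap K _ c⁻¹ * Λ.w i := by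
  have hz : (scaledHooks μ c ∘ hookVar K) (Λ.box i) =
      MvPolynomial.C c⁻¹ * MvPolynomial.X (Λ.hook i) := by
    have hh := (Λ.hook i).2
    simp only [Function.comp_apply, hookVar, scaledHooks, MvPolynomial.aeval_X]
    exact dif_pos hh
  rw [weight, hz, map_mul, map_mul, AlgHom.commutes, ← MvPolynomial.algebraMap_eq,
    AlgHom.commutes, mul_left_comm]
  rfl

theorem w_ne_zero (i : Fin μ.card) : Λ.w i ≠ 0 := by
  refine mul_ne_zero ?_ ?_
  · rw [Ne, map_eq_zero]; exact zpow_ne_zero _ q_ne_zero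
  · exact (map_ne_zero_iff (toField (PrincipalHook μ)) toField_injective).2
      (MvPolynomial.X_ne_zero _)

theorem box_injective : Function.Injective Λ.box := fun _ _ h =>
  Λ.fill.symm.injective (Subtype.ext h)

/-- Equal weights would mean the same hook and the same content, and a diagonal meets a hook only
once. -/
theorem scaledHooks_ne {c : K} (hc : c ≠ 0) {i j : Fin μ.card} (hij : i ≠ j) :
    weight q (scaledHooks μ c ∘ hookVar K) (Λ.box j) -
      weight q (scaledHooks μ c ∘ hookVar K) (Λ.box i) ≠ 0 := by
  have hz : ∀ i, weight q (scaledHooks μ c ∘ hookVar K) (Λ.box i) =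
      MvPolynomial.monomial (Finsupp.single (Λ.hook i) 1)
        (q ^ (2 * content (Λ.box i)) * c⁻¹) := by
    intro i
    have hh := (Λ.hook i).2
    have : (scaledHooks μ c ∘ hookVar K) (Λ.box i) =
        MvPolynomial.C c⁻¹ * MvPolynomial.X (Λ.hook i) := by
      simp only [Function.comp_apply, hookVar, scaledHooks, MvPolynomial.aeval_X]
      exact dif_pos hh
    rw [weight, this, MvPolynomial.algebraMap_eq, ← mul_assoc, ← map_mul,
      MvPolynomial.C_mul_X_eq_monomial]
  have hne : ∀ i, q ^ (2 * content (Λ.box i)) * c⁻¹ ≠ 0 := fun i =>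
    mul_ne_zero (zpow_ne_zero _ q_ne_zero) (inv_ne_zero hc)
  rw [sub_ne_zero, hz, hz]
  intro h
  rw [MvPolynomial.monomial_eq_monomial_iff] at h
  rcases h with ⟨h1, h2⟩ | ⟨h1, -⟩
  · rw [Finsupp.single_left_inj one_ne_zero] at h1
    have h3 := mul_right_cancel₀ (inv_ne_zero hc) h2
    have h4 := eq_of_zpow_eq q_ne_zero q_zpow_ne_one h3
    have h5 : min (Λ.box j).1 (Λ.box j).2 = min (Λ.box i).1 (Λ.box i).2 :=
      congrArg Subtype.val h1
    refine hij (box_injective Λ ?_)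
    unfold content at h4
    ext <;> omega
  · exact hne _ h1

theorem baxter_eq_smul_factor {a b c : RatField S} (k : ℕ) (hc : c ≠ 0) (ha : a ≠ 0)
    (hab : c * b - c * a ≠ 0) :
    baxter (extGen (RatField S) (HookFusion.T n)) (algebraMap K _ (q - q⁻¹)) k (c * a) (c * b) =
      (c * b - c * a) • factor n k a b := by
  have h : algebraMap (RatField S) (HeckeRat S n)
      (algebraMap K (RatField S) (q - q⁻¹) / (a⁻¹ * b - 1)) =
      (algebraMap K (RatField S) (q - q⁻¹) / (a⁻¹ * b - 1)) • 1 :=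
    Algebra.algebraMap_eq_smul_one _
  rw [baxter, factor, smul_add, extGen, h, smul_smul, ← baxter_coeff hc ha hab]

theorem scalarMap_word_eq {c : K} (hc : c ≠ 0) :
    scalarMap (HeckeAlgebra μ.card) (toField _)
        (word (HookFusion.T μ.card) q (scaledHooks μ c ∘ hookVar K) (boxes Λ)) =
      toField _ (pairProd (fun a b => weight q (scaledHooks μ c ∘ hookVar K) b -
        weight q (scaledHooks μ c ∘ hookVar K) a) (boxes Λ)) • Λ.fusionProduct := by
  have hc' : algebraMap K (RatField (PrincipalHook μ)) c⁻¹ ≠ 0 := by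
    rw [Ne, map_eq_zero]; exact inv_ne_zero hc
  have h1 := prod_orderedPairs (n := μ.card) fun k i j => factor μ.card k (Λ.w i) (Λ.w j)
  rw [StandardTableau.fusionProduct, h1, scalarMap_word, word, boxes, List.ofFn_eq_map,
    ← fullWord_comp, ← pairProd_comp]
  rw [algHom_pairProd, ← fullWord_smul]
  refine fullWord_congr ((List.nodup_finRange _).imp fun {i j} hij k => ?_)
  have hne := (map_ne_zero_iff (toField (PrincipalHook μ)) toField_injective).2
    (scaledHooks_ne Λ hc hij)
  rw [map_sub, toField_weight, toField_weight] at hne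
  rw [crossing, ← map_weight (toField _), ← map_weight (toField _), toField_weight, toField_weight,
    baxter_eq_smul_factor k hc' (w_ne_zero Λ i) hne, map_sub, toField_weight,
    toField_weight]

/-- The factors F_k depend only on ratios, so dividing all variables by c moves the point (c, …, c)
to (1, …, 1); hence one v serves every c. The remaining denominators belong to different contents
and have a nonzero value on the line. -/
theorem isFusionElement {v : HeckeAlgebra μ.card}
    (hv : HasVal (HookFusion.T μ.card) q (evalOne K ℕ) (hookVar K) (boxes Λ) v) :
    Λ.IsFusionElement ((lineDenominator Λ)⁻¹ • v) := by
  intro c hc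
  obtain ⟨D, X, hD, hX, rfl⟩ := hv.map (scaledHooks μ c) _ (aeval_scaledHooks hc)
  set z := scaledHooks μ c ∘ hookVar K
  set ε : MvPolynomial (PrincipalHook μ) K →ₐ[K] K := MvPolynomial.aeval fun _ => c
  have hεz : ∀ p, ε (z p) = 1 := fun p => by
    change (ε.comp (scaledHooks μ c)) (hookVar K p) = 1
    rw [aeval_scaledHooks hc]; simp [evalOne, hookVar]
  have hreg : ε (pairProd (regularPart q z) (boxes Λ)) = lineDenominator Λ := by
    rw [algHom_pairProd]
    refine pairProd_congr (List.pairwise_of_forall fun a b => ?_)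
    rw [regularPart]
    split_ifs
    · exact map_one _
    · rw [map_sub, eval_weight hεz, eval_weight hεz]
  have hpol : pairProd (polar q z) (boxes Λ) ≠ 0 := by
    rw [boxes, List.ofFn_eq_map, ← pairProd_comp]
    refine pairProd_ne_zero ((List.nodup_finRange _).imp fun {i j} hij => ?_)
    unfold polar
    split_ifs
    · exact scaledHooks_ne Λ hc hij
    · exact one_ne_zero
  refine ⟨X, D * pairProd (regularPart q z) (boxes Λ), ?_, ?_, ?_⟩
  · change ε _ ≠ 0
    rw [map_mul, hreg]
    exact mul_ne_zero hD (lineDenominator_ne_zero Λ)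
  -- The product of all differences splits into polar and regular part; the polar part cancels in
  -- the field of fractions.
  · have h := congrArg (scalarMap (HeckeAlgebra μ.card) (toField _)) hX
    rw [scalarMap_smul, scalarMap_smul, scalarMap_word_eq Λ hc,
      ← pairProd_congr (List.pairwise_of_forall fun a b => polar_mul_regularPart q z a b),
      pairProd_mul, smul_smul, ← map_mul, mul_left_comm, map_mul, mul_smul] at h
    rw [toRat_eq]
    exact smul_right_injective _ ((map_ne_zero_iff _ toField_injective).2 hpol) h
  · change _ = (ε _)⁻¹ • evalMap _ ε X
    rw [map_mul, hreg, mul_inv, smul_smul, mul_comm]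

end Fusion

end HeckeFusion

theorem corollary2p9 (μ : YoungDiagram) (Λ : HookFusion.StandardTableau μ) :
    ∃ F : HookFusion.HeckeAlgebra μ.card,
      (Λ.IsFusionElement F ∧ ∀ F' : HookFusion.HeckeAlgebra μ.card, Λ.IsFusionElement F' → F' = F) ∧
      (∀ (k a b : ℕ) (h : (a, b) ∈ μ) (h' : (a + 1, b) ∈ μ),
        Λ.entry (a, b) h = k → Λ.entry (a + 1, b) h' = k + 1 →
          ∃ G : HookFusion.HeckeAlgebra μ.card,
            F = (HookFusion.T μ.card k
              - algebraMap HookFusion.K (HookFusion.HeckeAlgebra μ.card) HookFusion.q) * G) ∧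
      (∀ (k a b : ℕ) (h : (a, b) ∈ μ) (h' : (a, b + 1) ∈ μ),
        Λ.entry (a, b) h = k → Λ.entry (a, b + 1) h' = k + 1 →
          ∃ G : HookFusion.HeckeAlgebra μ.card,
            F = (HookFusion.T μ.card k
              + algebraMap HookFusion.K (HookFusion.HeckeAlgebra μ.card) HookFusion.q⁻¹) * G) := by
  obtain ⟨v, hv, hrow, hcol⟩ := HeckeFusion.exists_value (HeckeFusion.isHecke_T _)
    HeckeFusion.q_ne_zero HeckeFusion.q_zpow_ne_one HeckeFusion.q_add_inv_ne_zero
    (HeckeFusion.isTableau_boxes Λ)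
  have hF := HeckeFusion.isFusionElement Λ hv
  have hq : HookFusion.q ≠ -HookFusion.q⁻¹ := fun h =>
    HeckeFusion.q_add_inv_ne_zero (by rw [← eq_neg_iff_add_eq_zero]; exact h)
  refine ⟨_, ⟨hF, fun F' hF' => ?_⟩, ?_, ?_⟩
  · exact HeckeFusion.IsRegularWithValue.unique (hF' 1 one_ne_zero) (hF 1 one_ne_zero)
  · intro k a b h h' hk hk'
    obtain ⟨A, E, hE, rfl⟩ := HeckeFusion.exists_boxes_eq Λ h h' hk hk'
    exact HeckeFusion.exists_eq_mul hq.symm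
      (by rw [mul_smul_comm, hcol a b A E hE, smul_zero])
  · intro k a b h h' hk hk'
    obtain ⟨A, E, hE, rfl⟩ := HeckeFusion.exists_boxes_eq Λ h h' hk hk'
    have := HeckeFusion.exists_eq_mul hq
      (show (HookFusion.T μ.card (A.length + 1) - HookFusion.q • 1) *
        ((HeckeFusion.lineDenominator Λ)⁻¹ • v) = 0 by
          rw [mul_smul_comm, hrow a b A E hE, smul_zero])
    simpa only [map_neg, sub_neg_eq_add] using this
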